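/- Let $1\le p<2$, let $U$ be a Banach space, $V$ a finite-dimensional real normed space and $T>0$. A control is a function $\omega:\{0\le s\le t\le T\}\to[0,\infty)$ with $\omega_{s,s}=0$ and $\omega_{r,s}+\omega_{s,t}\le\omega_{r,t}$ for $r\le s\le t$, such that for every $\delta>0$ there is $\epsilon>0$ with $\omega_{s,t}<\delta$ whenever $s\le t\le s+\epsilon$. Let $x:[0,T]\to U$ be a continuous path of finite $p$-variation controlled by $\omega$, i.e. $|x_t-x_s|\le C\omega_{s,t}^{1/p}$ for some constant $C$ and all $0\le s\le t\le T$. Let $f\in\mathcal C_b^1(V,\mathcal L(U,V))$, meaning here that $f$ is bounded and Lipschitz (this includes bounded $C^1$ maps with bounded derivative). Put $\varpi(u)=u^{2/p}$ and $$\phi_{t,s}(a)=a+f(a)(x_t-x_s),\qquad 0\le s\le t\le T,\ a\in V.$$ (i) There are a constant $K\ge1$ and a non-decreasing function $\delta:[0,\infty)\to[0,\infty)$ with $\delta_\tau\to0$ as $\tau\to0^+$ such that, with $N(a)=K(1+|f(a)|)$ (a Lipschitz function with values in $[1,\infty)$), $\phi$ is a Lipschitz almost flow: $(s,t)\mapsto\phi_{t,s}(a)$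 is continuous for each $a$, $\phi_{t,t}(a)=a$; for all $0\le s\le t\le\tau\le T$ and $a,b\in V$, $$|\phi_{t,s}(a)-a|\le\delta_\tau N(a),\qquad |\phi_{t,s}(a)-\phi_{t,s}(b)|\le(1+\delta_\tau)|a-b|;$$ and for all $0\le r\le s\le t\le T$ and $a\in V$, $$|\phi_{t,s}(\phi_{s,r}(a))-\phi_{t,r}(a)|\le N(a)\varpi(\omega_{r,t}).$$ Moreover there is a flow $\psi$ in the galaxy of $\phi$, that is, a family of maps $\psi_{t,s}:V\to V$, $0\le s\le t\le T$, with $\psi_{t,t}(a)=a$ and $\psi_{t,s}(\psi_{s,r}(a))=\psi_{t,r}(a)$ for all $0\le r\le s\le t\le T$ and $a\in V$, and a constant $C'$ with $$|\phi_{t,s}(a)-\psi_{t,s}(a)|\le C'N(a)\varpi(\omega_{s,t})\qquad\text{for all }0\le s\le t\le T,\ a\in V,$$ such that every $\psi_{t,s}$ is Borel measurable and every path $t\in[s,T]\mapsto\psi_{t,s}(a)$ is continuous. (Continuity in $s$ is not claimed.) (ii) No uniqueness of solutions is assumed in (i), and it may fail: for every $1<p<2$ there are $T>0$, a control $\omega$,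 a path $x$ in some $\mathbb R^d$ of finite $p$-variation controlled by $\omega$, a bounded Lipschitz $f:\mathbb R^m\to\mathcal L(\mathbb R^d,\mathbb R^m)$, and a point $a\in\mathbb R^m$ for which there are two different solutions in the sense of Davie of $y_t=a+\int_0^t f(y_s)\,dx_s$ on $[0,T]$, i.e. two different continuous paths $y:[0,T]\to\mathbb R^m$ with $y_0=a$ and $|y_t-\phi_{t,s}(y_s)|\le C''\omega_{s,t}^{2/p}$ for some constant $C''$ and all $0\le s\le t\le T$. -/

import Mathlib

open Set Filter Topology

/-- The simplex of pairs of times `(s, t)` with `0 ≤ s ≤ t ≤ T`. -/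
def timeSimplex (T : ℝ) : Set (ℝ × ℝ) := {q | 0 ≤ q.1 ∧ q.1 ≤ q.2 ∧ q.2 ≤ T}

/-- A control on `[0, T]`: a nonnegative super-additive function `ω s t` of the pairs
`0 ≤ s ≤ t ≤ T`, zero on the diagonal and uniformly small close to the diagonal. Values of `ω`
outside the simplex play no role. -/
structure IsControl (T : ℝ) (ω : ℝ → ℝ → ℝ) : Prop where
  nonneg : ∀ s t, 0 ≤ s → s ≤ t → t ≤ T → 0 ≤ ω s t
  diag : ∀ s, 0 ≤ s → s ≤ T → ω s s = 0
  superadditive : ∀ r s t, 0 ≤ r → r ≤ s → s ≤ t → t ≤ T → ω r s + ω s t ≤ ω r t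
  small : ∀ δ > 0, ∃ ε > 0, ∀ s t, 0 ≤ s → s ≤ t → t ≤ T → t ≤ s + ε → ω s t < δ

/-- `x` restricted to `[0, T]` is a (continuous) path of finite `p`-variation controlled
by `ω`. -/
def HasFinitePVariation {U : Type*} [PseudoMetricSpace U] (T p : ℝ) (ω : ℝ → ℝ → ℝ)
    (x : ℝ → U) : Prop :=
  ContinuousOn x (Icc 0 T) ∧
    ∃ C : ℝ, ∀ s t, 0 ≤ s → s ≤ t → t ≤ T → dist (x s) (x t) ≤ C * ω s t ^ (1 / p)

/-- A remainder: a continuous increasing function `ϖ : [0, ∞) → [0, ∞)` such that, for some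
`0 < κ < 1`, `2 ϖ(δ / 2) ≤ κ ϖ(δ)` for all `δ > 0`. -/
structure IsRemainder (ϖ : ℝ → ℝ) : Prop where
  nonneg : ∀ δ, 0 ≤ δ → 0 ≤ ϖ δ
  continuousOn : ContinuousOn ϖ (Ici 0)
  strictMonoOn : StrictMonoOn ϖ (Ici 0)
  halving : ∃ κ : ℝ, 0 < κ ∧ κ < 1 ∧ ∀ δ > 0, 2 * ϖ (δ / 2) ≤ κ * ϖ δ

/-- A Lipschitz almost flow `φ t s : V → V`, `0 ≤ s ≤ t ≤ T`, with respect to the control `ω`, the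
remainder `ϖ`, the Lipschitz weight `N : V → [1, ∞)` and the function `δ` of the time horizon.
The conditions that involve `δ` hold for every horizon `τ ≤ T`. -/
structure IsLipschitzAlmostFlow {V : Type*} [PseudoMetricSpace V] (T : ℝ) (ω : ℝ → ℝ → ℝ)
    (ϖ : ℝ → ℝ) (N : V → ℝ) (δ : ℝ → ℝ) (φ : ℝ → ℝ → V → V) : Prop where
  remainder : IsRemainder ϖ
  one_le_weight : ∀ a, 1 ≤ N a
  weight_lipschitz : ∃ L, LipschitzWith L N
  delta_nonneg : ∀ τ, 0 ≤ τ → 0 ≤ δ τ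
  delta_mono : MonotoneOn δ (Ici 0)
  delta_tendsto : Tendsto δ (𝓝[>] 0) (𝓝 0)
  continuous_times : ∀ a, ContinuousOn (fun q : ℝ × ℝ => φ q.2 q.1 a) (timeSimplex T)
  map_self : ∀ t a, 0 ≤ t → t ≤ T → φ t t a = a
  near_id : ∀ τ s t a, 0 ≤ s → s ≤ t → t ≤ τ → τ ≤ T → dist (φ t s a) a ≤ δ τ * N a
  lipschitz : ∀ τ s t a b, 0 ≤ s → s ≤ t → t ≤ τ → τ ≤ T →
    dist (φ t s a) (φ t s b) ≤ (1 + δ τ) * dist a b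
  almost_comp : ∀ r s t a, 0 ≤ r → r ≤ s → s ≤ t → t ≤ T →
    dist (φ t s (φ s r a)) (φ t r a) ≤ N a * ϖ (ω r t)

/-- A flow `ψ t s : V → V`, `0 ≤ s ≤ t ≤ T`; no continuity in `(s, t)` is part of the notion. -/
structure IsFlow {V : Type*} (T : ℝ) (ψ : ℝ → ℝ → V → V) : Prop where
  map_self : ∀ t a, 0 ≤ t → t ≤ T → ψ t t a = a
  comp : ∀ r s t a, 0 ≤ r → r ≤ s → s ≤ t → t ≤ T → ψ t s (ψ s r a) = ψ t r a

/-- The relation that defines galaxies: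
`d(φ_{t,s}(a), ψ_{t,s}(a)) ≤ C N(a) ϖ(ω_{s,t})` with one constant `C` for all `a` and
`0 ≤ s ≤ t ≤ T`. -/
def SameGalaxy {V : Type*} [PseudoMetricSpace V] (T : ℝ) (ω : ℝ → ℝ → ℝ)
    (ϖ : ℝ → ℝ) (N : V → ℝ) (φ ψ : ℝ → ℝ → V → V) : Prop :=
  ∃ C : ℝ, ∀ s t a, 0 ≤ s → s ≤ t → t ≤ T →
    dist (φ t s a) (ψ t s a) ≤ C * N a * ϖ (ω s t)

/-- `y` is a solution on `[r, T]` in the sense of Davie, started from `a` at time `r`, for the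
algorithm `φ`. -/
def IsDSolution {V : Type*} [PseudoMetricSpace V] (T : ℝ) (ω : ℝ → ℝ → ℝ)
    (ϖ : ℝ → ℝ) (N : V → ℝ) (φ : ℝ → ℝ → V → V) (r : ℝ) (a : V) (y : ℝ → V) : Prop :=
  ContinuousOn y (Icc r T) ∧ y r = a ∧
    ∃ K : ℝ, ∀ s t, r ≤ s → s ≤ t → t ≤ T → dist (y t) (φ t s (y s)) ≤ K * N a * ϖ (ω s t)

/-- The class `C_b^{r + γ}` with `r = 0` and `γ = 1`: bounded Lipschitz functions. It contains the
bounded continuously differentiable functions with bounded derivative. -/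
def IsBoundedLipschitz {V W : Type*} [PseudoMetricSpace V] [SeminormedAddCommGroup W]
    (f : V → W) : Prop :=
  (∃ M : ℝ, ∀ a, ‖f a‖ ≤ M) ∧ ∃ L, LipschitzWith L f

/-- The Euler scheme `φ_{t,s}(a) = a + f(a) (x_t - x_s)`. -/
def eulerScheme {U V : Type*} [NormedAddCommGroup U] [NormedSpace ℝ U]
    [NormedAddCommGroup V] [NormedSpace ℝ V] (f : V → U →L[ℝ] V) (x : ℝ → U)
    (t s : ℝ) (a : V) : V :=
  a + f a (x t - x s)

/-!
The flow in the galaxy of the Euler scheme `φ` is found by selecting, in a measurable and consistent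
way, one solution for each starting time and starting point.

Existence. The local error `y t - φ t s (y s)` of a path is additive up to the defect
`(f (y l) - f (y s)) (x t - x l)`. Since `2 / p > 1`, cutting an interval at half of its control gains
a factor less than `1`, and the defect can be absorbed because `f` is bounded and Lipschitz
(`exists_isSplittingBound_eulerScheme`). Hence discrete schemes satisfy `|y t - φ t s (y s)| ≤
L ω ^ (2 / p)` with a constant `L` that does not depend on the mesh, and every path satisfying such
a bound with some constant satisfies it with this `L` (`IsSplittingBound.dist_le_of_scheme`,
`IsSplittingBound.dist_le`). For fixed `L` the condition is closed under pointwise convergence, so by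
Tychonoff's theorem the solutions from a given point form a nonempty compact set in the pointwise
topology. The universal constant also makes these sets stable under concatenation.

Selection. Enumerate the pairs of a rational time `q` and a point of a dense sequence, and keep
successively only those solutions that maximize, among the remaining ones with the same starting
point, the distance to that point at time `q`. As `q` is a fixed time, the refined sets are again
stable under restriction and concatenation. In the limit a single solution is left for each starting
point, and stability under restriction is the flow property. Each refinement preserves the
measurability of the set-valued map that sends a starting point to its set of solutions
(`IsSelectable.exists_isFlow`).

Non-uniqueness. For the spiral `x u = (u cos (1 / u), - u sin (1 / u))` the area form
`x⁰ dx¹ - x¹ dx⁰` is `du`. On the dyadic scale `2 ^ (-n)` there are about `2 ^ n` loops of radius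
`2 ^ (-n)`, so the `p`-variation is finite for all `p > 1`, with control proportional to
`t ^ (p - 1) - s ^ (p - 1)`. The equation `dh = x⁰ dx¹ - x¹ dx⁰`, with coefficients truncated at
`|h|` to make `h = 0` a solution, is also solved by `h u = u`, since the radius of the spiral is
exactly `u`. The truncated coefficients are bounded and Lipschitz.
-/

/-! ### Controls -/

theorem exists_mul_rpow_lt (C : ℝ) {θ ε : ℝ} (hθ : 0 < θ) (hε : 0 < ε) :
    ∃ η > 0, ∀ u, 0 ≤ u → u < η → C * u ^ θ < ε := by
  refine ⟨(ε / (|C| + 1)) ^ (1 / θ), by positivity, fun u hu hlt => ?_⟩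
  have h1 : u ^ θ < ε / (|C| + 1) := by
    have := Real.rpow_lt_rpow hu hlt hθ
    rwa [← Real.rpow_mul (by positivity), one_div_mul_cancel hθ.ne', Real.rpow_one] at this
  have h2 : 0 ≤ u ^ θ := Real.rpow_nonneg hu _
  calc C * u ^ θ ≤ (|C| + 1) * u ^ θ := by
        gcongr
        linarith [le_abs_self C]
    _ < (|C| + 1) * (ε / (|C| + 1)) := by gcongr
    _ = ε := by field_simp

namespace IsControl

variable {T : ℝ} {ω : ℝ → ℝ → ℝ}

theorem mono (h : IsControl T ω) {r s t u : ℝ} (hr : 0 ≤ r) (hrs : r ≤ s) (hst : s ≤ t)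
    (htu : t ≤ u) (hu : u ≤ T) : ω s t ≤ ω r u := by
  have h1 := h.superadditive r s t hr hrs hst (htu.trans hu)
  have h2 := h.superadditive r t u hr (hrs.trans hst) htu hu
  have h3 := h.nonneg r s hr hrs (hst.trans (htu.trans hu))
  have h4 := h.nonneg t u (hr.trans (hrs.trans hst)) htu hu
  linarith

theorem small_rpow (h : IsControl T ω) (C : ℝ) {θ ε : ℝ} (hθ : 0 < θ) (hε : 0 < ε) :
    ∃ η > 0, ∀ s t, 0 ≤ s → s ≤ t → t ≤ T → t ≤ s + η → C * ω s t ^ θ < ε := by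
  obtain ⟨η, hη, H⟩ := exists_mul_rpow_lt C hθ hε
  obtain ⟨η', hη', H'⟩ := h.small η hη
  exact ⟨η', hη', fun s t hs hst ht hd => H _ (h.nonneg s t hs hst ht) (H' s t hs hst ht hd)⟩

theorem continuousOn_of_dist_le (h : IsControl T ω) {E : Type*} [PseudoMetricSpace E]
    {y : ℝ → E} {r C θ : ℝ} (hr : 0 ≤ r) (hθ : 0 < θ)
    (hy : ∀ s t, r ≤ s → s ≤ t → t ≤ T → dist (y s) (y t) ≤ C * ω s t ^ θ) :
    ContinuousOn y (Icc r T) := by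
  rw [Metric.continuousOn_iff]
  intro b hb ε hε
  obtain ⟨η, hη, H⟩ := h.small_rpow C hθ hε
  refine ⟨η, hη, fun a ha hab => ?_⟩
  rw [Real.dist_eq, abs_lt] at hab
  rcases le_total a b with hle | hle
  · exact (hy a b ha.1 hle hb.2).trans_lt
      (H a b (hr.trans ha.1) hle hb.2 (by linarith [hab.1]))
  · rw [dist_comm]
    exact (hy b a hb.1 hle ha.2).trans_lt
      (H b a (hr.trans hb.1) hle ha.2 (by linarith [hab.2]))

/-- A control need not be continuous, so an interval has no point at which it splits into halves;
it does split into two parts carrying at most half of it, up to an arbitrarily small gap. -/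
theorem exists_split (h : IsControl T ω) {s t ε : ℝ} (hs : 0 ≤ s) (hst : s ≤ t) (ht : t ≤ T)
    (hε : 0 < ε) : ∃ l l', s ≤ l ∧ l ≤ l' ∧ l' ≤ t ∧ ω s l ≤ ω s t / 2 ∧ ω l' t ≤ ω s t / 2 ∧
      ω l l' < ε := by
  obtain ⟨η, hη, H⟩ := h.small ε hε
  have hn := h.nonneg s t hs hst ht
  set A : Set ℝ := {u | s ≤ u ∧ u ≤ t ∧ ω s u ≤ ω s t / 2} with hA
  have hsA : s ∈ A := ⟨le_rfl, hst, by rw [h.diag s hs (hst.trans ht)]; linarith⟩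
  have hbdd : BddAbove A := ⟨t, fun u hu => hu.2.1⟩
  obtain ⟨l, hl, hlt⟩ := exists_lt_of_lt_csSup ⟨s, hsA⟩
    (show sSup A - η / 2 < sSup A by linarith)
  have hlu : l ≤ sSup A := le_csSup hbdd hl
  refine ⟨l, min t (sSup A + η / 2), hl.1, le_min hl.2.1 (by linarith), min_le_left _ _, hl.2.2,
    ?_, ?_⟩
  · rcases le_total t (sSup A + η / 2) with hle | hle
    · rw [min_eq_left hle, h.diag t (hs.trans hst) ht]
      linarith
    · rw [min_eq_right hle]
      have hs' : s ≤ sSup A + η / 2 := by linarith [hl.1]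
      have hnot : sSup A + η / 2 ∉ A := fun hmem => by linarith [le_csSup hbdd hmem]
      have hgt : ω s t / 2 < ω s (sSup A + η / 2) := by
        by_contra hcon
        exact hnot ⟨hs', hle, not_lt.mp hcon⟩
      linarith [h.superadditive s _ t hs hs' hle ht]
  · exact H _ _ (hs.trans hl.1) (le_min hl.2.1 (by linarith)) ((min_le_left _ _).trans ht)
      ((min_le_right _ _).trans (by linarith))

end IsControl

theorem isRemainder_rpow {θ : ℝ} (hθ : 1 < θ) : IsRemainder (fun u => u ^ θ) where
  nonneg δ hδ := Real.rpow_nonneg hδ _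
  continuousOn := (Real.continuous_rpow_const (by linarith)).continuousOn
  strictMonoOn := Real.strictMonoOn_rpow_Ici_of_exponent_pos (by linarith)
  halving := by
    refine ⟨2 * (1 / 2) ^ θ, by positivity, ?_, fun δ hδ => ?_⟩
    · have := Real.rpow_lt_rpow_of_exponent_gt (x := 1 / 2) (by norm_num) (by norm_num) hθ
      rw [Real.rpow_one] at this
      linarith
    · rw [div_eq_mul_one_div, Real.mul_rpow hδ.le (by norm_num)]
      exact le_of_eq (by ring)

/-! ### The Davie estimate -/

/-- The discrete scheme on the finite set `F`: it has the value `a` at the first time, and moves by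
`φ` from each time to the next one. -/
theorem exists_scheme {V : Type*} (φ : ℝ → ℝ → V → V) (a : V) (F : Finset ℝ) :
    ∃ y : ℝ → V, (∀ u ∈ F, (∀ w ∈ F, u ≤ w) → y u = a) ∧
      ∀ u ∈ F, ∀ v ∈ F, u < v → (∀ w ∈ F, u < w → v ≤ w) → y v = φ v u (y u) := by
  classical
  induction F using Finset.induction_on_max with
  | empty => exact ⟨fun _ => a, by simp, by simp⟩
  | insert m F hm ih =>
    obtain ⟨y, hy0, hy⟩ := ih
    rcases F.eq_empty_or_nonempty with rfl | hF
    · refine ⟨fun _ => a, by simp, ?_⟩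
      intro u hu v hv huv
      simp only [insert_empty_eq, Finset.mem_singleton] at hu hv
      linarith
    · have hmax := F.max'_mem hF
      have hne : ∀ u ∈ F, u ≠ m := fun u hu => (hm u hu).ne
      refine ⟨Function.update y m (φ m (F.max' hF) (y (F.max' hF))), ?_, ?_⟩
      · intro u hu hmin
        rcases Finset.mem_insert.mp hu with rfl | hu
        · have := hmin _ (Finset.mem_insert_of_mem hmax)
          linarith [hm _ hmax]
        · rw [Function.update_of_ne (hne u hu)]
          exact hy0 u hu fun w hw => hmin w (Finset.mem_insert_of_mem hw)
      · intro u hu v hv huv hcons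
        have huF : u ∈ F := by
          rcases Finset.mem_insert.mp hu with rfl | hu
          · rcases Finset.mem_insert.mp hv with rfl | hv
            · exact absurd huv (lt_irrefl _)
            · linarith [hm v hv]
          · exact hu
        rw [Function.update_of_ne (hne u huF)]
        rcases Finset.mem_insert.mp hv with rfl | hv
        · have : u = F.max' hF := by
            rcases (F.le_max' u huF).eq_or_lt with h | h
            · exact h
            · linarith [hcons _ (Finset.mem_insert_of_mem hmax) h, hm _ hmax]
          rw [Function.update_self, this]
        · rw [Function.update_of_ne (hne v hv)]
          exact hy u huF v hv huv fun w hw => hcons w (Finset.mem_insert_of_mem hw)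

section Davie

variable {V : Type*} [NormedAddCommGroup V] {T θ : ℝ} {ω : ℝ → ℝ → ℝ}

/-- The inequality that drives the Davie estimate: if `[s, t]` is cut into `[s, l]`, `[l, l']`,
`[l', t]`, the outer parts carrying at most half of `ω s t`, and `y` follows `φ` on each part up to
`B ω ^ θ`, then it follows `φ` on `[s, t]` up to `(κ B + D) ω ^ θ` and its error on `[l, l']`. It is
used with `κ < 1`, where `B ↦ κ B + D` has a fixed point. -/
def IsSplittingBound (T : ℝ) (ω : ℝ → ℝ → ℝ) (θ : ℝ) (φ : ℝ → ℝ → V → V) (κ D : ℝ) : Prop :=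
  ∀ (y : ℝ → V) (B : ℝ), 0 ≤ B → ∀ s l l' t, 0 ≤ s → s ≤ l → l ≤ l' → l' ≤ t → t ≤ T →
    ω s l ≤ ω s t / 2 → ω l' t ≤ ω s t / 2 →
    dist (y l) (φ l s (y s)) ≤ B * ω s l ^ θ →
    dist (y l') (φ l' l (y l)) ≤ B * ω l l' ^ θ →
    dist (y t) (φ t l' (y l')) ≤ B * ω l' t ^ θ →
    dist (y t) (φ t s (y s)) ≤ (κ * B + D) * ω s t ^ θ + dist (y l') (φ l' l (y l))

/-- A path that follows `φ` up to `B ω ^ θ` does so with the universal constant `D / (1 - κ)`. -/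
theorem IsSplittingBound.dist_le {φ : ℝ → ℝ → V → V} {κ D : ℝ} (hφ : IsSplittingBound T ω θ φ κ D)
    (hω : IsControl T ω) (hθ : 0 < θ) (hκ0 : 0 ≤ κ) (hκ1 : κ < 1) (hD : 0 ≤ D) {y : ℝ → V}
    {r B : ℝ} (hr : 0 ≤ r) (hB : 0 ≤ B)
    (hy : ∀ s t, r ≤ s → s ≤ t → t ≤ T → dist (y t) (φ t s (y s)) ≤ B * ω s t ^ θ) :
    ∀ s t, r ≤ s → s ≤ t → t ≤ T → dist (y t) (φ t s (y s)) ≤ D / (1 - κ) * ω s t ^ θ := by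
  have h1κ : 0 < 1 - κ := by linarith
  have hL : 0 ≤ D / (1 - κ) := by positivity
  have key : ∀ n : ℕ, ∀ s t, r ≤ s → s ≤ t → t ≤ T →
      dist (y t) (φ t s (y s)) ≤ (κ ^ n * B + D / (1 - κ)) * ω s t ^ θ := by
    intro n
    induction n with
    | zero =>
      intro s t hs hst ht
      have := Real.rpow_nonneg (hω.nonneg s t (hr.trans hs) hst ht) θ
      refine (hy s t hs hst ht).trans ?_
      gcongr
      simpa using hL
    | succ n ih =>
      intro s t hs hst ht
      have hs0 := hr.trans hs
      refine le_of_forall_pos_le_add fun ε hε => ?_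
      have hBn : 0 ≤ κ ^ n * B + D / (1 - κ) := by positivity
      obtain ⟨η, hη, H⟩ := exists_mul_rpow_lt (κ ^ n * B + D / (1 - κ)) hθ hε
      obtain ⟨l, l', h1, h2, h3, h4, h5, h6⟩ := hω.exists_split hs0 hst ht hη
      have hll := ih l l' (hs.trans h1) h2 (h3.trans ht)
      have := hφ y _ hBn s l l' t hs0 h1 h2 h3 ht h4 h5
        (ih s l hs h1 (h2.trans (h3.trans ht))) hll
        (ih l' t (hs.trans (h1.trans h2)) h3 ht)
      have hlt := H _ (hω.nonneg l l' (hs0.trans h1) h2 (h3.trans ht)) h6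
      have e : κ * (κ ^ n * B + D / (1 - κ)) + D = κ ^ (n + 1) * B + D / (1 - κ) := by
        field_simp
        ring
      rw [e] at this
      linarith
  intro s t hs hst ht
  have hlim : Tendsto (fun n : ℕ => (κ ^ n * B + D / (1 - κ)) * ω s t ^ θ) atTop
      (𝓝 ((0 * B + D / (1 - κ)) * ω s t ^ θ)) :=
    (((tendsto_pow_atTop_nhds_zero_of_lt_one hκ0 hκ1).mul_const B).add_const _).mul_const _
  rw [zero_mul, zero_add] at hlim
  exact ge_of_tendsto' hlim fun n => key n s t hs hst ht

/-- The Davie estimate for the discrete scheme on a finite set of times, with the same universal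
constant. -/
theorem IsSplittingBound.dist_le_of_scheme {φ : ℝ → ℝ → V → V} {κ D : ℝ}
    (hφ : IsSplittingBound T ω θ φ κ D) (hω : IsControl T ω) (hκ1 : κ < 1)
    (hD : 0 ≤ D) (hφid : ∀ t a, 0 ≤ t → t ≤ T → φ t t a = a) {F : Finset ℝ}
    (hF : ∀ u ∈ F, u ∈ Icc 0 T) {y : ℝ → V}
    (hy : ∀ u ∈ F, ∀ v ∈ F, u < v → (∀ w ∈ F, u < w → v ≤ w) → y v = φ v u (y u)) :
    ∀ s ∈ F, ∀ t ∈ F, s ≤ t → dist (y t) (φ t s (y s)) ≤ D / (1 - κ) * ω s t ^ θ := by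
  have h1κ : 0 < 1 - κ := by linarith
  have hL : 0 ≤ D / (1 - κ) := by positivity
  have hLe : κ * (D / (1 - κ)) + D = D / (1 - κ) := by
    field_simp
    ring
  have key : ∀ n : ℕ, ∀ s ∈ F, ∀ t ∈ F, s ≤ t → (F.filter (fun w => s ≤ w ∧ w ≤ t)).card ≤ n →
      dist (y t) (φ t s (y s)) ≤ D / (1 - κ) * ω s t ^ θ := by
    intro n
    induction n with
    | zero =>
      intro s hs t ht hst hc
      have : s ∈ F.filter (fun w => s ≤ w ∧ w ≤ t) := by simp [hs, hst]
      have := Finset.card_pos.mpr ⟨s, this⟩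
      omega
    | succ n ih =>
      intro s hs t ht hst hc
      have hs0 := (hF s hs).1
      have htT := (hF t ht).2
      have hn := hω.nonneg s t hs0 hst htT
      rcases hst.eq_or_lt with rfl | hlt
      · rw [hφid s _ hs0 htT, dist_self]
        positivity
      -- `l` is the last time before `t` with at most half of the control on `[s, l]`
      obtain ⟨l, hl, hlmax⟩ := (F.filter (fun w => s ≤ w ∧ w < t ∧ ω s w ≤ ω s t / 2)).exists_max_image
        id ⟨s, by simp only [Finset.mem_filter]
                  exact ⟨hs, le_rfl, hlt, by rw [hω.diag s hs0 (hst.trans htT)]; linarith⟩⟩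
      simp only [Finset.mem_filter, id] at hl hlmax
      obtain ⟨hlF, hsl, hlt', hlω⟩ := hl
      -- `l'` is the time that follows `l`
      obtain ⟨l', hl', hlmin⟩ := (F.filter (fun w => l < w)).exists_min_image
        id ⟨t, by simp only [Finset.mem_filter]; exact ⟨ht, hlt'⟩⟩
      simp only [Finset.mem_filter, id] at hl' hlmin
      obtain ⟨hlF', hll'⟩ := hl'
      have hl't : l' ≤ t := hlmin t ⟨ht, hlt'⟩
      have hstep : y l' = φ l' l (y l) := hy l hlF l' hlF' hll' fun w hw hlw => hlmin w ⟨hw, hlw⟩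
      have hl'ω : ω l' t ≤ ω s t / 2 := by
        rcases hl't.eq_or_lt with rfl | hlt''
        · rw [hω.diag l' (hF l' hlF').1 htT]
          linarith
        · have : ω s t / 2 < ω s l' := by
            by_contra hcon
            have := hlmax l' ⟨hlF', by linarith, hlt'', not_lt.mp hcon⟩
            linarith
          linarith [hω.superadditive s l' t hs0 (by linarith) hl't htT]
      have c1 : (F.filter (fun w => s ≤ w ∧ w ≤ l)).card ≤ n := by
        refine Nat.lt_succ_iff.mp ((Finset.card_lt_card ?_).trans_le hc)
        rw [Finset.ssubset_iff_of_subset]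
        · exact ⟨t, by simp [ht, hst], by simp [hlt']⟩
        · intro w
          simp only [Finset.mem_filter]
          exact fun hw => ⟨hw.1, hw.2.1, by linarith [hw.2.2]⟩
      have c2 : (F.filter (fun w => l' ≤ w ∧ w ≤ t)).card ≤ n := by
        refine Nat.lt_succ_iff.mp ((Finset.card_lt_card ?_).trans_le hc)
        rw [Finset.ssubset_iff_of_subset]
        · refine ⟨s, by simp [hs, hst], ?_⟩
          simp only [Finset.mem_filter, not_and]
          intro _ h
          linarith
        · intro w
          simp only [Finset.mem_filter]
          exact fun hw => ⟨hw.1, by linarith [hw.2.1], hw.2.2⟩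
      have hzero : dist (y l') (φ l' l (y l)) = 0 := by rw [← hstep, dist_self]
      have hnl := hω.nonneg l l' (hs0.trans hsl) hll'.le (hl't.trans htT)
      have := hφ y _ hL s l l' t hs0 hsl hll'.le hl't htT hlω hl'ω (ih s hs l hlF hsl c1)
        (by rw [hzero]; positivity) (ih l' hlF' t ht hl't c2)
      rwa [hzero, add_zero, hLe] at this
  exact fun s hs t ht hst => key _ s hs t ht hst le_rfl

end Davie

/-! ### Selection of a measurable flow -/

section Selection

variable {V : Type*}

/-- Successive refinements of a family of sets of paths: at stage `k`, only those paths are kept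
that maximize `ℓ k` at the time `q k`, among the paths left with the same starting point. -/
def lexRefine (S : ℝ → Set (ℝ → V)) (q : ℕ → ℝ) (ℓ : ℕ → V → ℝ) : ℕ → ℝ → Set (ℝ → V)
  | 0, s => S s
  | k + 1, s => {y ∈ lexRefine S q ℓ k s |
      s ≤ q k → ∀ z ∈ lexRefine S q ℓ k s, z s = y s → ℓ k (z (q k)) ≤ ℓ k (y (q k))}

variable {T : ℝ} {S : ℝ → Set (ℝ → V)} {q : ℕ → ℝ} {ℓ : ℕ → V → ℝ}

theorem lexRefine_succ_subset (k : ℕ) (s : ℝ) :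
    lexRefine S q ℓ (k + 1) s ⊆ lexRefine S q ℓ k s := fun _ hy => hy.1

variable [NormedAddCommGroup V]

/-- A family of sets of paths, the paths in `S s` being thought of as defined on `[s, T]`, that is
rich enough for a flow to be selected from it. Restricted paths are set to zero before their new
starting time. Compactness refers to pointwise convergence. -/
structure IsSelectable (T : ℝ) (S : ℝ → Set (ℝ → V)) : Prop where
  exists_start : ∀ s, 0 ≤ s → s ≤ T → ∀ a, ∃ y ∈ S s, y s = a
  isCompact : ∀ s, 0 ≤ s → s ≤ T → ∀ R : ℝ, IsCompact {y ∈ S s | y s ∈ Metric.closedBall 0 R}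
  continuousOn : ∀ s, 0 ≤ s → s ≤ T → ∀ y ∈ S s, ContinuousOn y (Icc s T)
  restrict : ∀ r s, 0 ≤ r → r ≤ s → s ≤ T → ∀ y ∈ S r, (fun t => if t < s then 0 else y t) ∈ S s
  concat : ∀ r s, 0 ≤ r → r ≤ s → s ≤ T → ∀ y ∈ S r, ∀ z ∈ S s, z s = y s →
    (fun t => if t < s then y t else z t) ∈ S r

/-- Stability under restriction and under concatenation have to be proved together: a restricted
path is maximal because its competitors can be concatenated to the original path, and a
concatenation is maximal because the restriction of the original path is a competitor of the
second piece. -/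
theorem IsSelectable.lexRefine_restrict_concat (hS : IsSelectable T S) (k : ℕ) {r s : ℝ}
    (hr : 0 ≤ r) (hrs : r ≤ s) (hs : s ≤ T) {y : ℝ → V} (hy : y ∈ lexRefine S q ℓ k r) :
    (fun t => if t < s then 0 else y t) ∈ lexRefine S q ℓ k s ∧
      ∀ z ∈ lexRefine S q ℓ k s, z s = y s →
        (fun t => if t < s then y t else z t) ∈ lexRefine S q ℓ k r := by
  induction k generalizing y with
  | zero =>
    exact ⟨hS.restrict r s hr hrs hs y hy, hS.concat r s hr hrs hs y hy⟩
  | succ k ih =>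
    obtain ⟨hy1, hy2⟩ := hy
    obtain ⟨hres, hcon⟩ := ih hy1
    have hstart : ∀ z : ℝ → V, z s = y s → (if r < s then y r else z r) = y r := by
      intro z hz
      split_ifs with h
      · rfl
      · obtain rfl : r = s := le_antisymm hrs (not_lt.mp h)
        exact hz
    refine ⟨⟨hres, fun hsq z hz hzs => ?_⟩, fun z hz hzs => ⟨hcon z hz.1 hzs, ?_⟩⟩
    · simp only [lt_self_iff_false, if_false] at hzs
      have := hy2 (hrs.trans hsq) _ (hcon z hz hzs) (hstart z hzs)
      simpa only [not_lt.mpr hsq, if_false] using this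
    · intro hrq w hw hwr
      have hwr' : w r = y r := hwr.trans (hstart z hzs)
      have hwy := hy2 hrq w hw hwr'
      by_cases hq : q k < s
      · simpa only [hq, if_true] using hwy
      · have hsq := not_lt.mp hq
        have := hz.2 hsq _ hres (by simp [hzs])
        simp only [hq, if_false] at this ⊢
        exact hwy.trans this

theorem IsSelectable.isCompact_fiber (hS : IsSelectable T S) (hℓ : ∀ k, Continuous (ℓ k))
    (k : ℕ) {s : ℝ} (hs0 : 0 ≤ s) (hs : s ≤ T) (a : V) :
    IsCompact {y ∈ lexRefine S q ℓ k s | y s = a} := by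
  induction k with
  | zero =>
    have h := (hS.isCompact s hs0 hs ‖a‖).inter_right
      (isClosed_singleton.preimage (continuous_apply s) : IsClosed {y : ℝ → V | y s ∈ ({a} : Set V)})
    convert h using 1
    ext y
    simp only [lexRefine, mem_ofPred_eq, mem_inter_iff, mem_closedBall_zero_iff]
    constructor
    · rintro ⟨h1, h2⟩
      exact ⟨⟨h1, by rw [h2]⟩, h2⟩
    · rintro ⟨⟨h1, -⟩, h2⟩
      exact ⟨h1, h2⟩
  | succ k ih =>
    have hcl : IsClosed {y : ℝ → V | s ≤ q k → ∀ z ∈ lexRefine S q ℓ k s, z s = a →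
        ℓ k (z (q k)) ≤ ℓ k (y (q k))} := by
      simp only [ofPred_forall]
      refine isClosed_iInter fun _ => isClosed_iInter fun z => isClosed_iInter fun _ =>
        isClosed_iInter fun _ => ?_
      exact isClosed_le continuous_const ((hℓ k).comp (continuous_apply _))
    convert ih.inter_right hcl using 1
    ext y
    constructor
    · rintro ⟨⟨h1, h2⟩, rfl⟩
      exact ⟨⟨h1, rfl⟩, h2⟩
    · rintro ⟨⟨h1, rfl⟩, h2⟩
      exact ⟨⟨h1, h2⟩, rfl⟩

theorem IsSelectable.nonempty_fiber (hS : IsSelectable T S) (hℓ : ∀ k, Continuous (ℓ k))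
    (k : ℕ) {s : ℝ} (hs0 : 0 ≤ s) (hs : s ≤ T) (a : V) :
    {y ∈ lexRefine S q ℓ k s | y s = a}.Nonempty := by
  induction k with
  | zero =>
    obtain ⟨y, hy, hya⟩ := hS.exists_start s hs0 hs a
    exact ⟨y, hy, hya⟩
  | succ k ih =>
    obtain ⟨y, hy, hmax⟩ := (hS.isCompact_fiber hℓ k hs0 hs a).exists_isMaxOn ih
      ((hℓ k).comp (continuous_apply (q k))).continuousOn
    exact ⟨y, ⟨hy.1, fun _ z hz hzs => hmax ⟨hz, hzs.trans hy.2⟩⟩, hy.2⟩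

/-- The refined sets of paths depend measurably on the starting point, in the sense of set-valued
maps. The maximum over a compact set of paths that meets the closed set `F` is the maximum over
the part in `F` if and only if the latter exceeds every rational number that the former does. -/
theorem IsSelectable.measurableSet_hit [MeasurableSpace V] [BorelSpace V]
    (hS : IsSelectable T S) (hℓ : ∀ k, Continuous (ℓ k)) (k : ℕ) {s : ℝ} (hs0 : 0 ≤ s)
    (hs : s ≤ T) {F : Set (ℝ → V)} (hF : IsClosed F) :
    MeasurableSet {a | ∃ y ∈ lexRefine S q ℓ k s, y ∈ F ∧ y s = a} := by
  induction k generalizing F with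
  | zero =>
    have e : {a | ∃ y ∈ lexRefine S q ℓ 0 s, y ∈ F ∧ y s = a} =
        ⋃ n : ℕ, (fun y : ℝ → V => y s) '' ({y ∈ S s | y s ∈ Metric.closedBall 0 (n : ℝ)} ∩ F) := by
      ext a
      simp only [lexRefine, mem_ofPred_eq, mem_iUnion, mem_image, mem_inter_iff,
        mem_closedBall_zero_iff]
      constructor
      · rintro ⟨y, hy, hyF, rfl⟩
        obtain ⟨n, hn⟩ := exists_nat_ge ‖y s‖
        exact ⟨n, y, ⟨⟨hy, hn⟩, hyF⟩, rfl⟩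
      · rintro ⟨n, y, ⟨⟨hy, -⟩, hyF⟩, rfl⟩
        exact ⟨y, hy, hyF, rfl⟩
    rw [e]
    exact MeasurableSet.iUnion fun n =>
      (((hS.isCompact s hs0 hs n).inter_right hF).image (continuous_apply s)).measurableSet
  | succ k ih =>
    by_cases hsq : s ≤ q k
    swap
    · simpa only [lexRefine, hsq, false_imp_iff, and_true, ofPred_mem_eq] using ih hF
    have hcl : ∀ c : ℚ, IsClosed {y : ℝ → V | (c : ℝ) ≤ ℓ k (y (q k))} := fun c =>
      isClosed_le continuous_const ((hℓ k).comp (continuous_apply _))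
    have e : {a | ∃ y ∈ lexRefine S q ℓ (k + 1) s, y ∈ F ∧ y s = a} =
        {a | ∃ y ∈ lexRefine S q ℓ k s, y ∈ F ∧ y s = a} ∩ ⋂ c : ℚ,
          ({a | ∃ y ∈ lexRefine S q ℓ k s, y ∈ {y | (c : ℝ) ≤ ℓ k (y (q k))} ∧ y s = a}ᶜ ∪
            {a | ∃ y ∈ lexRefine S q ℓ k s, y ∈ F ∩ {y | (c : ℝ) ≤ ℓ k (y (q k))} ∧ y s = a}) := by
      ext a
      simp only [mem_inter_iff, mem_iInter, mem_union, mem_compl_iff, mem_ofPred_eq]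
      constructor
      · rintro ⟨y, ⟨hy, hmax⟩, hyF, rfl⟩
        refine ⟨⟨y, hy, hyF, rfl⟩, fun c => or_iff_not_imp_left.mpr fun hc => ?_⟩
        obtain ⟨z, hz, hcz, hzs⟩ := not_not.mp hc
        exact ⟨y, hy, ⟨hyF, hcz.trans (hmax hsq z hz hzs)⟩, rfl⟩
      · rintro ⟨⟨y₀, hy₀, hy₀F, hy₀a⟩, H⟩
        obtain ⟨y, ⟨⟨hy, hya⟩, hyF⟩, hmax⟩ :=
          ((hS.isCompact_fiber (q := q) hℓ k hs0 hs a).inter_right hF).exists_isMaxOn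
            ⟨y₀, ⟨hy₀, hy₀a⟩, hy₀F⟩ ((hℓ k).comp (continuous_apply (q k))).continuousOn
        refine ⟨y, ⟨hy, fun _ z hz hzs => ?_⟩, hyF, hya⟩
        by_contra hlt
        obtain ⟨c, hc1, hc2⟩ := exists_rat_btwn (not_le.mp hlt)
        rcases H c with hc | ⟨w, hw, ⟨hwF, hcw⟩, hwa⟩
        · exact hc ⟨z, hz, hc2.le, hzs.trans hya⟩
        · have : ℓ k (w (q k)) ≤ ℓ k (y (q k)) := hmax ⟨⟨hw, hwa⟩, hwF⟩
          linarith
    rw [e]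
    exact (ih hF).inter (MeasurableSet.iInter fun c =>
      (ih (hcl c)).compl.union (ih (hF.inter (hcl c))))

theorem eqOn_Icc_of_rat {E : Type*} [TopologicalSpace E] [T2Space E] {y z : ℝ → E} {s T : ℝ}
    (hy : ContinuousOn y (Icc s T)) (hz : ContinuousOn z (Icc s T)) (hs : y s = z s)
    (h : ∀ q : ℚ, s ≤ q → y q = z q) : EqOn y z (Icc s T) := by
  rcases lt_trichotomy s T with hlt | rfl | hgt
  · have hEq : EqOn y z (Ioo s T ∩ range ((↑) : ℚ → ℝ)) := by
      rintro _ ⟨ht, q, rfl⟩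
      exact h q ht.1.le
    refine hEq.of_subset_closure hy hz (inter_subset_left.trans Ioo_subset_Icc_self) ?_
    rw [← closure_Ioo hlt.ne]
    exact closure_minimal (Rat.denseRange_cast.open_subset_closure_inter isOpen_Ioo)
      isClosed_closure
  · rw [Icc_self]
    rintro _ rfl
    exact hs
  · rw [Icc_eq_empty (not_le.mpr hgt)]
    exact eqOn_empty _ _

/-- From a selectable family of sets of paths one can select a Borel measurable flow. -/
theorem IsSelectable.exists_isFlow [SecondCountableTopology V] [MeasurableSpace V] [BorelSpace V]
    (hS : IsSelectable T S) :
    ∃ ψ : ℝ → ℝ → V → V, IsFlow T ψ ∧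
      (∀ s t, 0 ≤ s → s ≤ t → t ≤ T → Measurable (ψ t s)) ∧
      ∀ s a, 0 ≤ s → s ≤ T → (fun t => ψ t s a) ∈ S s ∧ ψ s s a = a := by
  -- maximize the distances to the points of a dense sequence, at all rational times
  obtain ⟨e, he⟩ : ∃ e : ℕ → ℚ × ℕ, Function.Surjective e := exists_surjective_nat _
  let q : ℕ → ℝ := fun k => (e k).1
  let ℓ : ℕ → V → ℝ := fun k v => dist (TopologicalSpace.denseSeq V (e k).2) v
  have hℓ : ∀ k, Continuous (ℓ k) := fun k => continuous_const.dist continuous_id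
  let R : ℕ → ℝ → Set (ℝ → V) := lexRefine S q ℓ
  have hex : ∀ s a, 0 ≤ s → s ≤ T → ∀ F : Set (ℝ → V), IsClosed F →
      (∀ k, ∃ y ∈ R k s, y ∈ F ∧ y s = a) → ∃ y, (∀ k, y ∈ R k s) ∧ y ∈ F ∧ y s = a := by
    intro s a hs0 hs F hF hk
    have hc := fun k => (hS.isCompact_fiber (q := q) hℓ k hs0 hs a).inter_right hF
    obtain ⟨y, hy⟩ := IsCompact.nonempty_iInter_of_sequence_nonempty_isCompact_isClosed
      (fun k => {y ∈ R k s | y s = a} ∩ F)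
      (fun k y hy => ⟨⟨lexRefine_succ_subset k s hy.1.1, hy.1.2⟩, hy.2⟩)
      (fun k => let ⟨y, h1, h2, h3⟩ := hk k; ⟨y, ⟨h1, h3⟩, h2⟩) (hc 0)
      (fun k => (hc k).isClosed)
    rw [mem_iInter] at hy
    exact ⟨y, fun k => (hy k).1.1, (hy 0).2, (hy 0).1.2⟩
  have huniq : ∀ s, 0 ≤ s → s ≤ T → ∀ y z, (∀ k, y ∈ R k s) → (∀ k, z ∈ R k s) → y s = z s →
      EqOn y z (Icc s T) := by
    intro s hs0 hs y z hy hz hyz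
    refine eqOn_Icc_of_rat (hS.continuousOn s hs0 hs y (hy 0))
      (hS.continuousOn s hs0 hs z (hz 0)) hyz fun c hc => ?_
    have hd : ∀ n, dist (TopologicalSpace.denseSeq V n) (y c) =
        dist (TopologicalSpace.denseSeq V n) (z c) := by
      intro n
      obtain ⟨k, hk⟩ := he (c, n)
      have hqk : q k = c := by simp [q, hk]
      have h1 := (hy (k + 1)).2 (hqk ▸ hc) z (hz k) hyz.symm
      have h2 := (hz (k + 1)).2 (hqk ▸ hc) y (hy k) hyz
      have := le_antisymm h2 h1
      simpa only [ℓ, hqk, hk] using this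
    have hfun : (fun v => dist v (y c)) = fun v => dist v (z c) :=
      (TopologicalSpace.denseRange_denseSeq V).equalizer (by fun_prop) (by fun_prop) (funext hd)
    have := congrFun hfun (z c)
    rw [dist_self] at this
    exact (dist_eq_zero.mp this).symm
  have hsel : ∀ s a, ∃ y : ℝ → V, 0 ≤ s → s ≤ T → (∀ k, y ∈ R k s) ∧ y s = a := by
    intro s a
    by_cases h : 0 ≤ s ∧ s ≤ T
    · obtain ⟨y, h1, -, h2⟩ := hex s a h.1 h.2 univ isClosed_univ fun k => by
        obtain ⟨y, hy, hya⟩ := hS.nonempty_fiber (q := q) hℓ k h.1 h.2 a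
        exact ⟨y, hy, mem_univ _, hya⟩
      exact ⟨y, fun _ _ => ⟨h1, h2⟩⟩
    · exact ⟨0, fun h1 h2 => absurd ⟨h1, h2⟩ h⟩
  choose Y hY using hsel
  refine ⟨fun t s a => Y s a t, ⟨fun t a h0 hT => (hY t a h0 hT).2, ?_⟩, ?_, ?_⟩
  · intro r s t a hr hrs hst ht
    have hsT := hst.trans ht
    have hYr := (hY r a hr (hrs.trans hsT)).1
    have hYs := hY s (Y r a s) (hr.trans hrs) hsT
    have := huniq s (hr.trans hrs) hsT _ (fun t => if t < s then 0 else Y r a t) hYs.1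
      (fun k => (hS.lexRefine_restrict_concat k hr hrs hsT (hYr k)).1) (by simp [hYs.2])
      ⟨hst, ht⟩
    simpa only [not_lt.mpr hst, if_false] using this
  · intro s t hs hst ht
    have hsT := hst.trans ht
    refine measurable_of_isClosed fun F hF => ?_
    have hF' : IsClosed {y : ℝ → V | y t ∈ F} := hF.preimage (continuous_apply t)
    have e : (fun a => Y s a t) ⁻¹' F =
        ⋂ k, {a | ∃ y ∈ R k s, y ∈ {y : ℝ → V | y t ∈ F} ∧ y s = a} := by
      ext a
      simp only [mem_preimage, mem_iInter]
      have hYs := hY s a hs hsT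
      constructor
      · exact fun h k => ⟨_, hYs.1 k, h, hYs.2⟩
      · intro h
        obtain ⟨y, hy, hyF, hya⟩ := hex s a hs hsT _ hF' h
        rw [huniq s hs hsT _ y hYs.1 hy (hYs.2.trans hya.symm) ⟨hst, ht⟩]
        exact hyF
    rw [e]
    exact MeasurableSet.iInter fun k => hS.measurableSet_hit hℓ k hs hsT hF'
  · exact fun s a hs hsT => ⟨(hY s a hs hsT).1 0, (hY s a hs hsT).2⟩

end Selection

/-! ### Compactness of the sets of solutions -/

section Solutions

variable {V : Type*} [NormedAddCommGroup V]

/-- The paths on `[s, T]`, extended by `0` to all of `ℝ`, that follow `φ` up to `L ω ^ θ`, with the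
fixed constant `L`. -/
def solutionSet (T : ℝ) (ω : ℝ → ℝ → ℝ) (θ : ℝ) (φ : ℝ → ℝ → V → V) (L s : ℝ) : Set (ℝ → V) :=
  {y | (∀ t, t ∉ Icc s T → y t = 0) ∧
    ∀ u v, s ≤ u → u ≤ v → v ≤ T → dist (y v) (φ v u (y u)) ≤ L * ω u v ^ θ}

variable {T θ ϑ A κ D L : ℝ} {ω : ℝ → ℝ → ℝ} {φ : ℝ → ℝ → V → V}

theorem dist_le_of_mem_solutionSet
    (hA : ∀ s t a, 0 ≤ s → s ≤ t → t ≤ T → dist (φ t s a) a ≤ A * ω s t ^ ϑ) {s : ℝ} (hs0 : 0 ≤ s)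
    {y : ℝ → V} (hy : y ∈ solutionSet T ω θ φ L s) {u v : ℝ} (hsu : s ≤ u) (huv : u ≤ v)
    (hv : v ≤ T) : dist (y v) (y u) ≤ L * ω u v ^ θ + A * ω u v ^ ϑ :=
  (dist_triangle _ (φ v u (y u)) _).trans
    (add_le_add (hy.2 u v hsu huv hv) (hA u v _ (hs0.trans hsu) huv hv))

theorem isClosed_solutionSet (hφ : ∀ s t, 0 ≤ s → s ≤ t → t ≤ T → Continuous (φ t s)) {s : ℝ}
    (hs0 : 0 ≤ s) : IsClosed (solutionSet T ω θ φ L s) := by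
  simp only [solutionSet, ofPred_and, ofPred_forall]
  refine IsClosed.inter (isClosed_iInter fun t => isClosed_iInter fun _ =>
    isClosed_eq (continuous_apply t) continuous_const) (isClosed_iInter fun u =>
    isClosed_iInter fun v => isClosed_iInter fun hu => isClosed_iInter fun huv =>
    isClosed_iInter fun hv => isClosed_le ?_ continuous_const)
  exact (continuous_apply v).dist ((hφ u v (hs0.trans hu) huv hv).comp (continuous_apply u))

theorem isCompact_solutionSet [ProperSpace V] (hω : IsControl T ω) (hθ : 0 ≤ θ) (hϑ : 0 ≤ ϑ)
    (hL : 0 ≤ L) (hA0 : 0 ≤ A) (hφ : ∀ s t, 0 ≤ s → s ≤ t → t ≤ T → Continuous (φ t s))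
    (hA : ∀ s t a, 0 ≤ s → s ≤ t → t ≤ T → dist (φ t s a) a ≤ A * ω s t ^ ϑ) {s : ℝ} (hs0 : 0 ≤ s)
    (hs : s ≤ T) (R : ℝ) :
    IsCompact {y ∈ solutionSet T ω θ φ L s | y s ∈ Metric.closedBall 0 R} := by
  have hW0 := hω.nonneg s T hs0 hs le_rfl
  set R' := R + (L * ω s T ^ θ + A * ω s T ^ ϑ) with hR'
  have hball : IsClosed {y : ℝ → V | y s ∈ Metric.closedBall 0 R} :=
    Metric.isClosed_closedBall.preimage (continuous_apply s)
  refine (isCompact_univ_pi fun _ : ℝ => isCompact_closedBall (0 : V) R').of_isClosed_subset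
    ((isClosed_solutionSet hφ hs0).inter hball) ?_
  rintro y ⟨hy, hyR⟩ t -
  rw [mem_closedBall_zero_iff] at hyR ⊢
  by_cases ht : t ∈ Icc s T
  · have h1 := dist_le_of_mem_solutionSet hA hs0 hy le_rfl ht.1 ht.2
    have hn := hω.nonneg s t hs0 ht.1 ht.2
    have hle := hω.mono hs0 le_rfl ht.1 ht.2 le_rfl
    have h2 : L * ω s t ^ θ + A * ω s t ^ ϑ ≤ L * ω s T ^ θ + A * ω s T ^ ϑ := by gcongr
    have h3 : ‖y t‖ ≤ ‖y s‖ + dist (y t) (y s) := by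
      rw [dist_eq_norm]
      exact norm_le_norm_add_norm_sub' _ _
    linarith
  · rw [hy.1 t ht, norm_zero]
    have := (norm_nonneg (y s)).trans hyR
    positivity

/-- Solutions exist: the condition for a solution is a closed one on each pair of times, and
discrete schemes satisfy any finite number of these conditions. -/
theorem exists_mem_solutionSet [ProperSpace V] (hω : IsControl T ω) (hθ : 0 ≤ θ) (hϑ : 0 ≤ ϑ)
    (hA0 : 0 ≤ A) (hφ : ∀ s t, 0 ≤ s → s ≤ t → t ≤ T → Continuous (φ t s))
    (hA : ∀ s t a, 0 ≤ s → s ≤ t → t ≤ T → dist (φ t s a) a ≤ A * ω s t ^ ϑ)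
    (hφid : ∀ t a, 0 ≤ t → t ≤ T → φ t t a = a) (hsplit : IsSplittingBound T ω θ φ κ D)
    (hκ1 : κ < 1) (hD : 0 ≤ D) {s : ℝ} (hs0 : 0 ≤ s) (hs : s ≤ T) (a : V) :
    ∃ y ∈ solutionSet T ω θ φ (D / (1 - κ)) s, y s = a := by
  classical
  have hL : 0 ≤ D / (1 - κ) := div_nonneg hD (by linarith)
  set L := D / (1 - κ) with hLdef
  have hW0 := hω.nonneg s T hs0 hs le_rfl
  set R := L * ω s T ^ θ + A * ω s T ^ ϑ with hR
  have hR0 : 0 ≤ R := by positivity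
  let I := {q : ℝ × ℝ // s ≤ q.1 ∧ q.1 ≤ q.2 ∧ q.2 ≤ T}
  let K : Set (ℝ → V) := univ.pi (fun t : ℝ => if t ∈ Icc s T then Metric.closedBall a R else {0}) ∩
    {y | y s = a}
  have hK : IsCompact K := by
    refine (isCompact_univ_pi fun t => ?_).inter_right
      (isClosed_eq (continuous_apply s) continuous_const)
    split_ifs
    exacts [isCompact_closedBall a R, isCompact_singleton]
  let Z : I → Set (ℝ → V) := fun q =>
    {y | dist (y q.1.2) (φ q.1.2 q.1.1 (y q.1.1)) ≤ L * ω q.1.1 q.1.2 ^ θ}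
  have hZ : ∀ q, IsClosed (Z q) := fun q => isClosed_le ((continuous_apply _).dist
    ((hφ _ _ (hs0.trans q.2.1) q.2.2.1 q.2.2.2).comp (continuous_apply _))) continuous_const
  obtain ⟨y, ⟨hyK, hya⟩, hyZ⟩ := hK.inter_iInter_nonempty Z hZ fun J => by
    let F : Finset ℝ := insert s (J.image (fun q => q.1.1) ∪ J.image (fun q => q.1.2))
    have hF : ∀ u ∈ F, s ≤ u ∧ u ≤ T := by
      intro u hu
      simp only [F, Finset.mem_insert, Finset.mem_union, Finset.mem_image] at hu
      rcases hu with rfl | ⟨q, -, rfl⟩ | ⟨q, -, rfl⟩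
      · exact ⟨le_rfl, hs⟩
      · exact ⟨q.2.1, q.2.2.1.trans q.2.2.2⟩
      · exact ⟨q.2.1.trans q.2.2.1, q.2.2.2⟩
    have hsF : s ∈ F := Finset.mem_insert_self _ _
    obtain ⟨y, hy0, hy⟩ := exists_scheme φ a F
    have hbound := hsplit.dist_le_of_scheme hω hκ1 hD hφid
      (fun u hu => ⟨hs0.trans (hF u hu).1, (hF u hu).2⟩) hy
    have hys := hy0 s hsF fun w hw => (hF w hw).1
    let y' : ℝ → V := fun t => if t ∈ F then y t else if t ∈ Icc s T then a else 0
    have hy'F : ∀ u ∈ F, y' u = y u := fun u hu => if_pos hu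
    refine ⟨y', ⟨fun t _ => ?_, by rw [mem_ofPred_eq, hy'F s hsF, hys]⟩, mem_iInter₂.mpr
      fun q hq => ?_⟩
    · by_cases htF : t ∈ F
      · have ht : t ∈ Icc s T := hF t htF
        simp only [hy'F t htF, if_pos ht, Metric.mem_closedBall]
        have h1 := hbound s hsF t htF ht.1
        rw [hys] at h1
        have h2 := hA s t a hs0 ht.1 ht.2
        have hn := hω.nonneg s t hs0 ht.1 ht.2
        have hle := hω.mono hs0 le_rfl ht.1 ht.2 le_rfl
        have h3 : L * ω s t ^ θ + A * ω s t ^ ϑ ≤ R := by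
          rw [hR]
          gcongr
        linarith [dist_triangle (y t) (φ t s a) a]
      · simp only [y', if_neg htF]
        split_ifs
        exacts [Metric.mem_closedBall_self hR0, rfl]
    · have m1 : q.1.1 ∈ F := Finset.mem_insert_of_mem
        (Finset.mem_union_left _ (Finset.mem_image_of_mem (fun q : I => q.1.1) hq))
      have m2 : q.1.2 ∈ F := Finset.mem_insert_of_mem
        (Finset.mem_union_right _ (Finset.mem_image_of_mem (fun q : I => q.1.2) hq))
      change dist (y' q.1.2) (φ q.1.2 q.1.1 (y' q.1.1)) ≤ _
      rw [hy'F _ m1, hy'F _ m2]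
      exact hbound _ m1 _ m2 q.2.2.1
  refine ⟨y, ⟨fun t ht => ?_, fun u v hu huv hv => ?_⟩, hya⟩
  · simpa only [if_neg ht, mem_singleton_iff] using hyK t (mem_univ t)
  · exact mem_iInter.mp hyZ ⟨(u, v), hu, huv, hv⟩

theorem restrict_mem_solutionSet {r s : ℝ} (hrs : r ≤ s) {y : ℝ → V}
    (hy : y ∈ solutionSet T ω θ φ L r) :
    (fun t => if t < s then 0 else y t) ∈ solutionSet T ω θ φ L s := by
  refine ⟨fun t ht => ?_, fun u v hu huv hv => ?_⟩
  · by_cases h : t < s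
    · exact if_pos h
    · simp only [if_neg h]
      exact hy.1 t fun hmem => ht ⟨not_lt.mp h, hmem.2⟩
  · simp only [if_neg (not_lt.mpr hu), if_neg (not_lt.mpr (hu.trans huv))]
    exact hy.2 u v (hrs.trans hu) huv hv

/-- The concatenation of two solutions follows `φ` with some constant, hence with the universal
one. -/
theorem concat_mem_solutionSet {N : V → ℝ} {δ : ℝ → ℝ} {B : ℝ} (hω : IsControl T ω)
    (hθ : 0 < θ) (hφ : IsLipschitzAlmostFlow T ω (fun u => u ^ θ) N δ φ) (hN : ∀ a, N a ≤ B)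
    (hsplit : IsSplittingBound T ω θ φ κ D) (hκ0 : 0 ≤ κ) (hκ1 : κ < 1) (hD : 0 ≤ D) {r s : ℝ}
    (hr : 0 ≤ r) (hrs : r ≤ s) (hs : s ≤ T) {y z : ℝ → V}
    (hy : y ∈ solutionSet T ω θ φ (D / (1 - κ)) r) (hz : z ∈ solutionSet T ω θ φ (D / (1 - κ)) s)
    (hzs : z s = y s) :
    (fun t => if t < s then y t else z t) ∈ solutionSet T ω θ φ (D / (1 - κ)) r := by
  have hL : 0 ≤ D / (1 - κ) := div_nonneg hD (by linarith)
  set L := D / (1 - κ) with hLdef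
  have hs0 := hr.trans hrs
  have hδ := hφ.delta_nonneg T (hs0.trans hs)
  have hB : 0 ≤ B := zero_le_one.trans ((hφ.one_le_weight 0).trans (hN 0))
  have hBL : 0 ≤ (1 + δ T) * L + B := by positivity
  refine ⟨fun t ht => ?_, ?_⟩
  · have h2 := hz.1 t fun hmem => ht ⟨hrs.trans hmem.1, hmem.2⟩
    by_cases h : t < s
    · simp only [if_pos h]
      exact hy.1 t ht
    · simp only [if_neg h, h2]
  · refine hsplit.dist_le hω hθ hκ0 hκ1 hD hr (B := L + ((1 + δ T) * L + B)) (by positivity) ?_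
    intro u v hu huv hv
    have hu0 := hr.trans hu
    have hn := Real.rpow_nonneg (hω.nonneg u v hu0 huv hv) θ
    have hle : L * ω u v ^ θ ≤ (L + ((1 + δ T) * L + B)) * ω u v ^ θ := by
      gcongr
      linarith
    by_cases h1 : v < s
    · simp only [if_pos h1, if_pos (huv.trans_lt h1)]
      exact (hy.2 u v hu huv hv).trans hle
    · by_cases h2 : u < s
      · simp only [if_neg h1, if_pos h2]
        have hsv := not_lt.mp h1
        have e1 := hz.2 s v le_rfl hsv hv
        have e2 := hφ.lipschitz T s v (y s) (φ s u (y u)) hs0 hsv hv le_rfl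
        have e3 := hy.2 u s hu h2.le hs
        have e4 := hφ.almost_comp u s v (y u) hu0 h2.le hsv hv
        have n1 := hω.nonneg s v hs0 hsv hv
        have n2 := hω.nonneg u s hu0 h2.le hs
        have m1 : ω s v ^ θ ≤ ω u v ^ θ := by
          have := hω.mono hu0 h2.le hsv le_rfl hv
          gcongr
        have m2 : ω u s ^ θ ≤ ω u v ^ θ := by
          have := hω.mono hu0 le_rfl h2.le hsv hv
          gcongr
        rw [hzs] at e1
        calc dist (z v) (φ v u (y u))
            ≤ dist (z v) (φ v s (y s)) + dist (φ v s (y s)) (φ v s (φ s u (y u)))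
              + dist (φ v s (φ s u (y u))) (φ v u (y u)) := dist_triangle4 _ _ _ _
          _ ≤ L * ω u v ^ θ + (1 + δ T) * (L * ω u v ^ θ) + B * ω u v ^ θ := by
              gcongr
              · exact e1.trans (by gcongr)
              · exact e2.trans (by gcongr; exact e3.trans (by gcongr))
              · exact e4.trans (by gcongr; exact hN _)
          _ = _ := by ring
      · simp only [if_neg h1, if_neg h2]
        exact (hz.2 u v (not_lt.mp h2) huv hv).trans hle

/-- The exponent `ϑ` of the modulus of continuity of `φ` in time gives the continuity of solutions. -/
theorem isSelectable_solutionSet [ProperSpace V] {N : V → ℝ} {δ : ℝ → ℝ} {B : ℝ}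
    (hω : IsControl T ω) (hθ : 1 ≤ θ) (hϑ0 : 0 < ϑ) (hϑ : ϑ ≤ θ) (hA0 : 0 ≤ A)
    (hφ : IsLipschitzAlmostFlow T ω (fun u => u ^ θ) N δ φ) (hN : ∀ a, N a ≤ B)
    (hA : ∀ s t a, 0 ≤ s → s ≤ t → t ≤ T → dist (φ t s a) a ≤ A * ω s t ^ ϑ)
    (hsplit : IsSplittingBound T ω θ φ κ D) (hκ0 : 0 ≤ κ) (hκ1 : κ < 1) (hD : 0 ≤ D) :
    IsSelectable T (solutionSet T ω θ φ (D / (1 - κ))) := by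
  have hθ0 : 0 < θ := by linarith
  have hL : 0 ≤ D / (1 - κ) := div_nonneg hD (by linarith)
  have hcont : ∀ s t, 0 ≤ s → s ≤ t → t ≤ T → Continuous (φ t s) := fun s t hs hst ht =>
    (LipschitzWith.of_dist_le_mul (K := (1 + δ T).toNNReal) fun a b =>
      (hφ.lipschitz T s t a b hs hst ht le_rfl).trans
        (by gcongr; exact Real.le_coe_toNNReal _)).continuous
  refine ⟨fun s hs0 hs a => exists_mem_solutionSet hω hθ0.le hϑ0.le hA0 hcont hA hφ.map_self
    hsplit hκ1 hD hs0 hs a, fun s hs0 hs R => isCompact_solutionSet hω hθ0.le hϑ0.le hL hA0 hcont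
    hA hs0 hs R, fun s hs0 hs y hy => ?_, fun r s _ hrs _ y hy => restrict_mem_solutionSet hrs hy,
    fun r s hr hrs hs y hy z hz hzs =>
      concat_mem_solutionSet hω hθ0 hφ hN hsplit hκ0 hκ1 hD hr hrs hs hy hz hzs⟩
  refine hω.continuousOn_of_dist_le hs0 hϑ0
    (C := D / (1 - κ) * ω 0 T ^ (θ - ϑ) + A) fun u v hu huv hv => ?_
  have hu0 := hs0.trans hu
  have hn := hω.nonneg u v hu0 huv hv
  have hle := hω.mono le_rfl hu0 huv hv le_rfl
  rw [dist_comm]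
  refine (dist_le_of_mem_solutionSet hA hs0 hy hu huv hv).trans ?_
  have e : ω u v ^ θ = ω u v ^ (θ - ϑ) * ω u v ^ ϑ := by
    rw [← Real.rpow_add_of_nonneg hn (by linarith) hϑ0.le, sub_add_cancel]
  rw [e, add_mul, ← mul_assoc]
  have h0 : 0 ≤ θ - ϑ := by linarith
  gcongr

end Solutions

/-! ### The Euler scheme driven by a path of finite `p`-variation, `p < 2` -/

section Euler

variable {U V : Type*} [NormedAddCommGroup U] [NormedSpace ℝ U] [NormedAddCommGroup V]
  [NormedSpace ℝ V] {T p C M : ℝ} {Λ : NNReal} {ω : ℝ → ℝ → ℝ} {x : ℝ → U} {f : V → U →L[ℝ] V}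

theorem rpow_two_div_eq_sq {u : ℝ} (hu : 0 ≤ u) (p : ℝ) : u ^ (2 / p) = (u ^ (1 / p)) ^ 2 := by
  rw [← Real.rpow_mul_natCast hu]
  congr 1
  push_cast
  ring

theorem dist_eulerScheme_self_le (hM : ∀ a, ‖f a‖ ≤ M)
    (hx : ∀ s t, 0 ≤ s → s ≤ t → t ≤ T → ‖x t - x s‖ ≤ C * ω s t ^ (1 / p)) {s t : ℝ} (hs : 0 ≤ s)
    (hst : s ≤ t) (ht : t ≤ T) (a : V) :
    dist (eulerScheme f x t s a) a ≤ M * C * ω s t ^ (1 / p) := by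
  have hM0 : 0 ≤ M := (norm_nonneg _).trans (hM a)
  rw [eulerScheme, dist_self_add_left, mul_assoc]
  refine ((f a).le_opNorm _).trans ?_
  gcongr
  exacts [hM a, hx s t hs hst ht]

/-- The defect of additivity of the local error of the Euler scheme. Close to the diagonal, the
factor `ε` comes from the Lipschitz bound on `f`, as the increments of `x` are small; away from it,
from the boundedness of `f`. -/
theorem exists_norm_euler_defect_le (hω : IsControl T ω) (hp : 0 < p) (hC : 0 ≤ C)
    (hM : ∀ a, ‖f a‖ ≤ M) (hf : LipschitzWith Λ f)
    (hx : ∀ s t, 0 ≤ s → s ≤ t → t ≤ T → ‖x t - x s‖ ≤ C * ω s t ^ (1 / p)) {ε : ℝ} (hε : 0 < ε) :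
    ∃ D : ℝ, 0 ≤ D ∧ ∀ (B : ℝ) (a b : V) (s l t : ℝ), 0 ≤ B → 0 ≤ s → s ≤ l → l ≤ t → t ≤ T →
      dist b (eulerScheme f x l s a) ≤ B * ω s l ^ (2 / p) →
      ‖(f b - f a) (x t - x l)‖ ≤ (ε * B + D) * ω s t ^ (2 / p) := by
  have hM0 : 0 ≤ M := (norm_nonneg _).trans (hM 0)
  set η : ℝ := ε / (Λ * C + 1) with hη
  have hη0 : 0 < η := by positivity
  refine ⟨2 * M * C / η + Λ * M * C ^ 2, by positivity, ?_⟩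
  intro B a b s l t hB hs hsl hlt ht hb
  have hp' : 0 < 1 / p := by positivity
  have hn1 := hω.nonneg s l hs hsl (hlt.trans ht)
  have hn2 := hω.nonneg l t (hs.trans hsl) hlt ht
  have hn := hω.nonneg s t hs (hsl.trans hlt) ht
  rw [rpow_two_div_eq_sq hn]
  rw [rpow_two_div_eq_sq hn1] at hb
  set W := ω s t ^ (1 / p) with hW
  have hW0 : 0 ≤ W := Real.rpow_nonneg hn _
  have hW1 : ω s l ^ (1 / p) ≤ W :=
    Real.rpow_le_rpow hn1 (hω.mono hs le_rfl hsl hlt ht) hp'.le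
  have hW2 : ω l t ^ (1 / p) ≤ W :=
    Real.rpow_le_rpow hn2 (hω.mono hs hsl hlt le_rfl ht) hp'.le
  have hW10 : 0 ≤ ω s l ^ (1 / p) := Real.rpow_nonneg hn1 _
  have hX : ‖x t - x l‖ ≤ C * W := (hx l t (hs.trans hsl) hlt ht).trans (by gcongr)
  have hop := (f b - f a).le_opNorm (x t - x l)
  rcases le_or_gt W η with hle | hgt
  · have h1 : dist b a ≤ B * W ^ 2 + M * C * W := by
      refine (dist_triangle b (eulerScheme f x l s a) a).trans (add_le_add (hb.trans ?_)
        ((dist_eulerScheme_self_le hM hx hs hsl (hlt.trans ht) a).trans ?_)) <;> gcongr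
    have h2 : ‖f b - f a‖ ≤ Λ * (B * W ^ 2 + M * C * W) := by
      rw [← dist_eq_norm]
      exact (hf.dist_le_mul b a).trans (by gcongr)
    have h3 : Λ * C * W ≤ ε := by
      have : Λ * C * η ≤ ε := by
        rw [hη, mul_div_assoc', div_le_iff₀ (by positivity)]
        nlinarith
      exact le_trans (by gcongr) this
    have h4 : 0 ≤ 2 * M * C / η := by positivity
    calc ‖(f b - f a) (x t - x l)‖ ≤ (Λ * (B * W ^ 2 + M * C * W)) * (C * W) :=
          hop.trans (by gcongr)
      _ = (Λ * C * W * B + Λ * M * C ^ 2) * W ^ 2 := by ring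
      _ ≤ (ε * B + (2 * M * C / η + Λ * M * C ^ 2)) * W ^ 2 := by
          gcongr
          linarith
  · have h2 : ‖f b - f a‖ ≤ 2 * M := by
      have := norm_sub_le (f b) (f a)
      linarith [hM a, hM b]
    have h4 : 0 ≤ ε * B := by positivity
    have h5 : (0 : ℝ) ≤ Λ * M * C ^ 2 := by positivity
    calc ‖(f b - f a) (x t - x l)‖ ≤ (2 * M) * (C * W) := hop.trans (by gcongr)
      _ = 2 * M * C / η * (η * W) := by field_simp
      _ ≤ 2 * M * C / η * (W * W) := by gcongr
      _ ≤ (ε * B + (2 * M * C / η + Λ * M * C ^ 2)) * W ^ 2 := by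
          rw [← sq]
          gcongr
          linarith

theorem sub_eulerScheme_eq (y : ℝ → V) (s l t : ℝ) :
    y t - eulerScheme f x t s (y s) = (y l - eulerScheme f x l s (y s)) +
      (y t - eulerScheme f x t l (y l)) + (f (y l) - f (y s)) (x t - x l) := by
  simp only [eulerScheme, map_sub, sub_apply]
  abel

theorem exists_isSplittingBound_eulerScheme (hω : IsControl T ω) (hp1 : 1 ≤ p) (hp2 : p < 2)
    (hC : 0 ≤ C) (hM : ∀ a, ‖f a‖ ≤ M) (hf : LipschitzWith Λ f)
    (hx : ∀ s t, 0 ≤ s → s ≤ t → t ≤ T → ‖x t - x s‖ ≤ C * ω s t ^ (1 / p)) :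
    ∃ κ D : ℝ, 0 ≤ κ ∧ κ < 1 ∧ 0 ≤ D ∧ IsSplittingBound T ω (2 / p) (eulerScheme f x) κ D := by
  have hp0 : 0 < p := by linarith
  have hθ : 1 < 2 / p := by rwa [lt_div_iff₀ hp0, one_mul]
  -- `κ₀` is the contraction gained by halving the control; the defects use up half of the gain
  set κ₀ : ℝ := 2 * (1 / 2) ^ (2 / p) with hκ₀
  have hκ₀1 : κ₀ < 1 := by
    have := Real.rpow_lt_rpow_of_exponent_gt (x := 1 / 2) (by norm_num) (by norm_num) hθ
    rw [Real.rpow_one] at this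
    linarith
  have hκ₀0 : 0 ≤ κ₀ := by positivity
  obtain ⟨D, hD, hdef⟩ := exists_norm_euler_defect_le hω hp0 hC hM hf hx
    (show 0 < (1 - κ₀) / 4 by linarith)
  refine ⟨κ₀ + 2 * ((1 - κ₀) / 4), 2 * D, by linarith, by linarith, by linarith, ?_⟩
  intro y B hB s l l' t hs hsl hll' hl't ht h1 h2 e1 e2 e3
  have hst := hsl.trans (hll'.trans hl't)
  have hl0 := hs.trans hsl
  have hlt := hll'.trans hl't
  have hn := hω.nonneg s t hs hst ht
  have hhalf : (ω s t / 2) ^ (2 / p) = (1 / 2) ^ (2 / p) * ω s t ^ (2 / p) := by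
    rw [← Real.mul_rpow (by norm_num) hn]
    congr 1
    ring
  have b1 : B * ω s l ^ (2 / p) ≤ B * ((1 / 2) ^ (2 / p) * ω s t ^ (2 / p)) := by
    have := hω.nonneg s l hs hsl (hlt.trans ht)
    rw [← hhalf]
    gcongr
  have b2 : B * ω l' t ^ (2 / p) ≤ B * ((1 / 2) ^ (2 / p) * ω s t ^ (2 / p)) := by
    have := hω.nonneg l' t (hl0.trans hll') hl't ht
    rw [← hhalf]
    gcongr
  have d1 := hdef B _ _ s l t hB hs hsl hlt ht e1
  have d2 := hdef B _ _ l l' t hB hl0 hll' hl't ht e2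
  have d3 : ((1 - κ₀) / 4 * B + D) * ω l t ^ (2 / p) ≤
      ((1 - κ₀) / 4 * B + D) * ω s t ^ (2 / p) := by
    have := hω.nonneg l t hl0 hlt ht
    have := hω.mono hs hsl hlt le_rfl ht
    have : 0 ≤ (1 - κ₀) / 4 := by linarith
    gcongr
  have hsum : κ₀ * B * ω s t ^ (2 / p) = 2 * (B * ((1 / 2) ^ (2 / p) * ω s t ^ (2 / p))) := by
    rw [hκ₀]
    ring
  simp only [dist_eq_norm] at e1 e2 e3 ⊢
  rw [sub_eulerScheme_eq y s l t, sub_eulerScheme_eq y l l' t]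
  refine (norm_add₃_le).trans ?_
  have := norm_add₃_le (a := y l' - eulerScheme f x l' l (y l))
    (b := y t - eulerScheme f x t l' (y l')) (c := (f (y l') - f (y l)) (x t - x l'))
  linarith

theorem isLipschitzAlmostFlow_eulerScheme (hT : 0 ≤ T) (hω : IsControl T ω) (hp1 : 1 ≤ p)
    (hp2 : p < 2) (hC : 0 ≤ C) (hf : LipschitzWith Λ f) (hxc : ContinuousOn x (Icc 0 T))
    (hx : ∀ s t, 0 ≤ s → s ≤ t → t ≤ T → ‖x t - x s‖ ≤ C * ω s t ^ (1 / p)) :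
    IsLipschitzAlmostFlow T ω (fun u => u ^ (2 / p)) (fun a => (1 + Λ * C ^ 2) * (1 + ‖f a‖))
      (fun τ => (1 + Λ) * C * ω 0 (min τ T) ^ (1 / p)) (eulerScheme f x) := by
  have hp0 : 0 < p := by linarith
  have hp' : 0 < 1 / p := by positivity
  have hθ : 1 < 2 / p := by rwa [lt_div_iff₀ hp0, one_mul]
  have hK : (1 : ℝ) ≤ 1 + Λ * C ^ 2 := le_add_of_nonneg_right (by positivity)
  have hωτ : ∀ τ, 0 ≤ τ → 0 ≤ ω 0 (min τ T) := fun τ hτ =>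
    hω.nonneg 0 _ le_rfl (le_min hτ hT) (min_le_right _ _)
  have hpow : ∀ τ s t, 0 ≤ s → s ≤ t → t ≤ τ → τ ≤ T →
      ω s t ^ (1 / p) ≤ ω 0 (min τ T) ^ (1 / p) := by
    intro τ s t hs hst htτ hτ
    rw [min_eq_left hτ]
    exact Real.rpow_le_rpow (hω.nonneg s t hs hst (htτ.trans hτ))
      (hω.mono le_rfl hs hst htτ hτ) hp'.le
  constructor
  · exact isRemainder_rpow hθ
  · exact fun a => one_le_mul_of_one_le_of_one_le hK (le_add_of_nonneg_right (norm_nonneg _))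
  · refine ⟨_, LipschitzWith.of_dist_le_mul (K := (1 + Λ * C ^ 2).toNNReal * Λ) fun a b => ?_⟩
    rw [NNReal.coe_mul, Real.coe_toNNReal _ (by positivity), Real.dist_eq, ← mul_sub, abs_mul,
      abs_of_nonneg (by positivity : (0 : ℝ) ≤ 1 + Λ * C ^ 2), add_sub_add_left_eq_sub, mul_assoc]
    gcongr
    refine (abs_norm_sub_norm_le _ _).trans ?_
    rw [← dist_eq_norm]
    exact hf.dist_le_mul a b
  · intro τ hτ
    have := hωτ τ hτ
    positivity
  · intro τ hτ σ hσ hτσ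
    have h1 := hωτ τ hτ
    have h2 : ω 0 (min τ T) ≤ ω 0 (min σ T) := hω.mono le_rfl le_rfl (le_min hτ hT)
      (min_le_min_right T hτσ) (min_le_right _ _)
    dsimp only
    gcongr
  · rw [Metric.tendsto_nhdsWithin_nhds]
    intro ε hε
    obtain ⟨η, hη, H⟩ := hω.small_rpow ((1 + Λ) * C) hp' hε
    refine ⟨η, hη, fun τ hτ hd => ?_⟩
    have hτ0 : 0 ≤ τ := (mem_Ioi.mp hτ).le
    have := hωτ τ hτ0
    rw [Real.dist_eq, sub_zero, abs_of_nonneg hτ0] at hd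
    rw [Real.dist_eq, sub_zero, abs_of_nonneg (by positivity)]
    exact H 0 _ le_rfl (le_min hτ0 hT) (min_le_right _ _) (by linarith [min_le_left τ T])
  · intro a
    refine continuousOn_const.add ((f a).continuous.comp_continuousOn ?_)
    refine (hxc.comp continuous_snd.continuousOn ?_).sub (hxc.comp continuous_fst.continuousOn ?_)
    · exact fun q hq => ⟨hq.1.trans hq.2.1, hq.2.2⟩
    · exact fun q hq => ⟨hq.1, hq.2.1.trans hq.2.2⟩
  · intro t a _ _
    simp [eulerScheme]
  · intro τ s t a hs hst htτ hτ
    have h0 := Real.rpow_nonneg (hω.nonneg s t hs hst (htτ.trans hτ)) (1 / p)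
    have h1 := hpow τ s t hs hst htτ hτ
    have h2 : 0 ≤ ω 0 (min τ T) ^ (1 / p) := h0.trans h1
    rw [eulerScheme, dist_self_add_left]
    calc ‖f a (x t - x s)‖ ≤ ‖f a‖ * (C * ω s t ^ (1 / p)) :=
          ((f a).le_opNorm _).trans (by gcongr; exact hx s t hs hst (htτ.trans hτ))
      _ ≤ (1 + ‖f a‖) * (C * ω 0 (min τ T) ^ (1 / p)) := by
          gcongr
          exact le_add_of_nonneg_left zero_le_one
      _ = 1 * C * ω 0 (min τ T) ^ (1 / p) * (1 * (1 + ‖f a‖)) := by ring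
      _ ≤ (1 + Λ) * C * ω 0 (min τ T) ^ (1 / p) * ((1 + Λ * C ^ 2) * (1 + ‖f a‖)) := by
          gcongr
          exact le_add_of_nonneg_right Λ.coe_nonneg
  · intro τ s t a b hs hst htτ hτ
    have h0 := Real.rpow_nonneg (hω.nonneg s t hs hst (htτ.trans hτ)) (1 / p)
    have h1 := hpow τ s t hs hst htτ hτ
    have h2 : 0 ≤ ω 0 (min τ T) ^ (1 / p) := h0.trans h1
    have e : eulerScheme f x t s a - eulerScheme f x t s b =
        (a - b) + (f a - f b) (x t - x s) := by
      simp only [eulerScheme, sub_apply]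
      abel
    have hfab : ‖f a - f b‖ ≤ Λ * dist a b := by
      rw [← dist_eq_norm]
      exact hf.dist_le_mul a b
    rw [dist_eq_norm, e]
    calc ‖(a - b) + (f a - f b) (x t - x s)‖
        ≤ dist a b + (Λ * dist a b) * (C * ω s t ^ (1 / p)) := by
          rw [dist_eq_norm] at hfab ⊢
          refine (norm_add_le _ _).trans ?_
          gcongr
          exact ((f a - f b).le_opNorm _).trans
            (by gcongr; exact hx s t hs hst (htτ.trans hτ))
      _ = (1 + Λ * C * ω s t ^ (1 / p)) * dist a b := by ring
      _ ≤ (1 + (1 + Λ) * C * ω 0 (min τ T) ^ (1 / p)) * dist a b := by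
          gcongr
          exact le_add_of_nonneg_left zero_le_one
  · intro r s t a hr hrs hst ht
    have n1 := hω.nonneg r s hr hrs (hst.trans ht)
    have n2 := hω.nonneg s t (hr.trans hrs) hst ht
    have n := hω.nonneg r t hr (hrs.trans hst) ht
    have m1 : ω r s ^ (1 / p) ≤ ω r t ^ (1 / p) :=
      Real.rpow_le_rpow n1 (hω.mono hr le_rfl hrs hst ht) hp'.le
    have m2 : ω s t ^ (1 / p) ≤ ω r t ^ (1 / p) :=
      Real.rpow_le_rpow n2 (hω.mono hr hrs hst le_rfl ht) hp'.le
    have e : eulerScheme f x t s (eulerScheme f x s r a) - eulerScheme f x t r a =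
        (f (eulerScheme f x s r a) - f a) (x t - x s) := by
      simp only [eulerScheme, map_sub, sub_apply]
      abel
    have hnear : ‖f (eulerScheme f x s r a) - f a‖ ≤
        Λ * (‖f a‖ * (C * ω r t ^ (1 / p))) := by
      rw [← dist_eq_norm]
      refine (hf.dist_le_mul _ _).trans ?_
      rw [eulerScheme, dist_self_add_left]
      gcongr
      exact ((f a).le_opNorm _).trans
        (by gcongr; exact (hx r s hr hrs (hst.trans ht)).trans (by gcongr))
    rw [dist_eq_norm, e, rpow_two_div_eq_sq n]
    have hW := Real.rpow_nonneg n (1 / p)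
    calc ‖(f (eulerScheme f x s r a) - f a) (x t - x s)‖
        ≤ (Λ * (‖f a‖ * (C * ω r t ^ (1 / p)))) * (C * ω r t ^ (1 / p)) :=
          (ContinuousLinearMap.le_opNorm _ _).trans
            (by gcongr; exact (hx s t (hr.trans hrs) hst ht).trans (by gcongr))
      _ = Λ * C ^ 2 * ‖f a‖ * (ω r t ^ (1 / p)) ^ 2 := by ring
      _ ≤ (1 + Λ * C ^ 2) * (1 + ‖f a‖) * (ω r t ^ (1 / p)) ^ 2 := by
          gcongr
          · exact le_add_of_nonneg_left zero_le_one
          · exact le_add_of_nonneg_left zero_le_one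

/-- The Euler scheme is a Lipschitz almost flow, and its galaxy contains a Borel measurable flow
with continuous paths. -/
theorem exists_measurable_flow_in_galaxy [FiniteDimensional ℝ V] [MeasurableSpace V]
    [BorelSpace V] (hp1 : 1 ≤ p) (hp2 : p < 2) (hT : 0 < T) (hω : IsControl T ω)
    (hx : HasFinitePVariation T p ω x) (hf : IsBoundedLipschitz f) :
    ∃ (K : ℝ) (δ : ℝ → ℝ), 1 ≤ K ∧
      IsLipschitzAlmostFlow T ω (fun u => u ^ (2 / p)) (fun a => K * (1 + ‖f a‖)) δ
        (eulerScheme f x) ∧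
      ∃ ψ : ℝ → ℝ → V → V,
        IsFlow T ψ ∧
        SameGalaxy T ω (fun u => u ^ (2 / p)) (fun a => K * (1 + ‖f a‖)) (eulerScheme f x) ψ ∧
        (∀ s t, 0 ≤ s → s ≤ t → t ≤ T → Measurable (ψ t s)) ∧
        (∀ s a, 0 ≤ s → s ≤ T → ContinuousOn (fun t => ψ t s a) (Icc s T)) := by
  obtain ⟨hxc, C₀, hC₀⟩ := hx
  obtain ⟨⟨M, hM⟩, Λ, hΛ⟩ := hf
  have hp0 : 0 < p := by linarith
  have hp' : 0 < 1 / p := by positivity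
  have hθ : 1 < 2 / p := by rwa [lt_div_iff₀ hp0, one_mul]
  have : ProperSpace V := FiniteDimensional.proper_real V
  set C := max C₀ 0 with hCdef
  have hC : 0 ≤ C := le_max_right _ _
  have hM0 : 0 ≤ M := (norm_nonneg _).trans (hM 0)
  have hx' : ∀ s t, 0 ≤ s → s ≤ t → t ≤ T → ‖x t - x s‖ ≤ C * ω s t ^ (1 / p) := by
    intro s t hs hst ht
    have := Real.rpow_nonneg (hω.nonneg s t hs hst ht) (1 / p)
    rw [← dist_eq_norm, dist_comm]
    exact (hC₀ s t hs hst ht).trans (by gcongr; exact le_max_left _ _)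
  have hflow := isLipschitzAlmostFlow_eulerScheme hT.le hω hp1 hp2 hC hΛ hxc hx'
  have hK : (1 : ℝ) ≤ 1 + Λ * C ^ 2 := le_add_of_nonneg_right (by positivity)
  refine ⟨1 + Λ * C ^ 2, _, hK, hflow, ?_⟩
  obtain ⟨κ, D, hκ0, hκ1, hD, hsplit⟩ :=
    exists_isSplittingBound_eulerScheme hω hp1 hp2 hC hM hΛ hx'
  have hL : 0 ≤ D / (1 - κ) := div_nonneg hD (by linarith)
  have hS := isSelectable_solutionSet (B := (1 + Λ * C ^ 2) * (1 + M)) (A := M * C) hω hθ.le hp'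
    (by gcongr; norm_num) (by positivity) hflow (fun a => by gcongr; exact hM a)
    (fun s t a hs hst ht => dist_eulerScheme_self_le hM hx' hs hst ht a) hsplit hκ0 hκ1 hD
  obtain ⟨ψ, hψ, hmeas, hmem⟩ := hS.exists_isFlow
  refine ⟨ψ, hψ, ⟨D / (1 - κ), fun s t a hs hst ht => ?_⟩, hmeas,
    fun s a hs hsT => hS.continuousOn s hs hsT _ (hmem s a hs hsT).1⟩
  obtain ⟨h1, h2⟩ := hmem s a hs (hst.trans ht)
  have h3 := h1.2 s t le_rfl hst ht
  simp only [h2] at h3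
  rw [dist_comm]
  refine h3.trans ?_
  have := Real.rpow_nonneg (hω.nonneg s t hs hst ht) (2 / p)
  gcongr
  exact le_mul_of_one_le_right hL (hflow.one_le_weight a)

end Euler

/-! ### Non-uniqueness for a spiral -/

section Spiral

theorem isControl_rpow {q : ℝ} (hq0 : 0 < q) (hq1 : q ≤ 1) :
    IsControl 1 (fun s t => (t ^ q - s ^ q) / q) where
  nonneg s t hs hst _ :=
    div_nonneg (sub_nonneg.mpr (Real.rpow_le_rpow hs hst hq0.le)) hq0.le
  diag s _ _ := by simp
  superadditive r s t _ _ _ _ := le_of_eq (by ring)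
  small δ hδ := by
    obtain ⟨η, hη, H⟩ := exists_mul_rpow_lt (1 / q) hq0 hδ
    refine ⟨η / 2, by linarith, fun s t hs hst _ hts => ?_⟩
    have h1 := Real.rpow_add_le_add_rpow hs (sub_nonneg.mpr hst) hq0.le hq1
    rw [add_sub_cancel] at h1
    have h2 := H (t - s) (by linarith) (by linarith)
    refine lt_of_le_of_lt ?_ h2
    rw [div_eq_mul_one_div, mul_comm]
    gcongr
    linarith

/-- By concavity, the control on `[s, t]` is at least `t ^ p v` with `v = (t - s) / t ^ 2`; the
increments of the spiral and the areas it sweeps are estimated in terms of `t` and `v`. -/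
theorem rpow_mul_le_rpow_sub_rpow_div {p s t : ℝ} (hp1 : 1 < p) (hp2 : p < 2) (hs : 0 ≤ s)
    (ht : 0 < t) : t ^ p * ((t - s) / t ^ 2) ≤ (t ^ (p - 1) - s ^ (p - 1)) / (p - 1) := by
  have hq : 0 < p - 1 := by linarith
  have hst' : 0 ≤ s / t := by positivity
  have h1 := rpow_one_add_le_one_add_mul_self (s := s / t - 1) (by linarith) hq.le (by linarith)
  rw [add_sub_cancel, Real.div_rpow hs ht.le, div_le_iff₀ (by positivity)] at h1
  rw [le_div_iff₀ hq]
  have e : t ^ p = t ^ (p - 1) * t := by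
    rw [← Real.rpow_add_one ht.ne', sub_add_cancel]
  have e2 : t ^ p * ((t - s) / t ^ 2) * (p - 1) =
      t ^ (p - 1) - (1 + (p - 1) * (s / t - 1)) * t ^ (p - 1) := by
    rw [e]
    field_simp
    ring
  rw [e2]
  linarith

/-- Increments of `t g(1 / t)` for a bounded Lipschitz `g`, in terms of `v = (t - s) / t ^ 2`: they
are at most of the order of `t`, and of the order of `t v` when `v` is small. -/
theorem abs_mul_comp_one_div_sub_le {g : ℝ → ℝ} (hg1 : ∀ a, |g a| ≤ 1)
    (hg : ∀ a b, |g a - g b| ≤ |a - b|) {s t e : ℝ} (hs : 0 ≤ s) (hst : s ≤ t) (ht : 0 < t)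
    (ht1 : t ≤ 1) (he0 : 0 ≤ e) (he1 : e ≤ 1) :
    |t * g (1 / t) - s * g (1 / s)| ≤ 2 * (t * ((t - s) / t ^ 2) ^ e) := by
  have hd : 0 ≤ t - s := by linarith
  set v := (t - s) / t ^ 2 with hv
  have hv0 : 0 ≤ v := by positivity
  have habs : ∀ a, 0 ≤ a → |a * g (1 / a)| ≤ a := fun a ha => by
    rw [abs_mul, abs_of_nonneg ha]
    exact mul_le_of_le_one_right ha (hg1 _)
  rcases le_or_gt 1 v with h | h
  · have h1 : 1 ≤ v ^ e := Real.one_le_rpow h he0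
    have h2 := abs_sub (t * g (1 / t)) (s * g (1 / s))
    have h3 : t * 1 ≤ t * v ^ e := by gcongr
    linarith [habs t ht.le, habs s hs]
  · have hve : v ≤ v ^ e := by
      rcases hv0.eq_or_lt with h0 | h0
      · rw [← h0]
        exact Real.rpow_nonneg le_rfl _
      · simpa using Real.rpow_le_rpow_of_exponent_ge h0 h.le he1
    have hs0 : 0 < s := by
      rw [hv, div_lt_one (by positivity)] at h
      nlinarith
    have e1 : t * v = (t - s) / t := by
      rw [hv]
      field_simp
    have e2 : |s * (g (1 / t) - g (1 / s))| ≤ (t - s) / t := by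
      rw [abs_mul, abs_of_pos hs0]
      calc s * |g (1 / t) - g (1 / s)| ≤ s * |1 / t - 1 / s| :=
          mul_le_mul_of_nonneg_left (hg _ _) hs
        _ = s * ((t - s) / (s * t)) := by
            congr 1
            rw [abs_sub_comm, ← abs_of_nonneg (show 0 ≤ (t - s) / (s * t) by positivity)]
            congr 1
            field_simp
        _ = (t - s) / t := by field_simp
    have e3 : |(t - s) * g (1 / t)| ≤ (t - s) / t := by
      rw [abs_mul, abs_of_nonneg hd]
      refine (mul_le_of_le_one_right hd (hg1 _)).trans ?_
      rw [le_div_iff₀ ht]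
      exact mul_le_of_le_one_right hd ht1
    have e4 : t * g (1 / t) - s * g (1 / s) =
        (t - s) * g (1 / t) + s * (g (1 / t) - g (1 / s)) := by ring
    rw [e4]
    have h3 : t * v ≤ t * v ^ e := by gcongr
    linarith [abs_add_le ((t - s) * g (1 / t)) (s * (g (1 / t) - g (1 / s)))]

/-- The area swept by the spiral between the times `s` and `t` differs from `t - s` by a quantity
controlled by a power of `(t - s) / t ^ 2`. -/
theorem abs_sub_area_le {s t e : ℝ} (hs : 0 ≤ s) (hst : s ≤ t) (ht : 0 < t) (ht1 : t ≤ 1)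
    (he1 : 1 ≤ e) (he2 : e ≤ 2) :
    |(t - s) - s * t * Real.sin (1 / s - 1 / t)| ≤ 4 * (t ^ 2 * ((t - s) / t ^ 2) ^ e) := by
  have hd : 0 ≤ t - s := by linarith
  set v := (t - s) / t ^ 2 with hv
  have hv0 : 0 ≤ v := by positivity
  have hve0 := Real.rpow_nonneg hv0 e
  have e1 : t - s = t ^ 2 * v := by
    rw [hv]
    field_simp
  rcases hs.eq_or_lt with rfl | hs0
  · have h1 : 1 ≤ v := by
      rw [hv, le_div_iff₀ (by positivity)]
      nlinarith
    have h2 : v ≤ v ^ e := by simpa using Real.rpow_le_rpow_of_exponent_le h1 he1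
    rw [zero_mul, zero_mul, sub_zero, abs_of_nonneg hd, e1]
    nlinarith [mul_le_mul_of_nonneg_left h2 (sq_nonneg t), mul_nonneg (sq_nonneg t) hve0]
  set w := 1 / s - 1 / t with hw
  have hstw : s * t * w = t - s := by
    rw [hw]
    field_simp
  have hw0 : 0 ≤ w := by
    rw [hw, sub_nonneg]
    gcongr
  have e2 : (t - s) - s * t * Real.sin w = s * t * (w - Real.sin w) := by
    rw [← hstw]
    ring
  rw [e2, abs_mul, abs_of_nonneg (show 0 ≤ s * t by positivity)]
  rcases le_or_gt 1 (2 * v) with h | h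
  · have h1 : 2 * v ≤ 4 * v ^ e := by
      calc 2 * v ≤ (2 * v) ^ e := by simpa using Real.rpow_le_rpow_of_exponent_le h he1
        _ = 2 ^ e * v ^ e := Real.mul_rpow (by norm_num) hv0
        _ ≤ 4 * v ^ e := by
            gcongr
            have := Real.rpow_le_rpow_of_exponent_le (show (1 : ℝ) ≤ 2 by norm_num) he2
            norm_num at this
            exact this
    have h2 : |w - Real.sin w| ≤ 2 * w := by
      have := abs_sub w (Real.sin w)
      have := Real.abs_sin_le_abs (x := w)
      rw [abs_of_nonneg hw0] at *
      linarith
    calc s * t * |w - Real.sin w| ≤ s * t * (2 * w) := by gcongr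
      _ = t ^ 2 * (2 * v) := by linear_combination 2 * hstw + 2 * e1
      _ ≤ t ^ 2 * (4 * v ^ e) := by gcongr
      _ = _ := by ring
  · have h1 : v ^ 2 ≤ v ^ e := by
      rcases hv0.eq_or_lt with h0 | h0
      · rw [← h0, Real.zero_rpow (by linarith)]
        norm_num
      · simpa using Real.rpow_le_rpow_of_exponent_ge h0 (by linarith : v ≤ 1) he2
    have hst2 : t ≤ 2 * s := by nlinarith
    have hw2 : w ≤ 2 * v := by
      have : s * t * w ≤ s * t * (2 * v) := by
        rw [hstw, e1]
        nlinarith [mul_nonneg (mul_nonneg ht.le hv0) (sub_nonneg.mpr hst2)]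
      exact le_of_mul_le_mul_left this (by positivity)
    have h2 : |w - Real.sin w| ≤ w * (2 * v) := by
      have h3 := Real.abs_sub_sin_le w
      rw [abs_of_nonneg hw0] at h3
      have h4 : w ^ 3 / 6 ≤ w * w := by nlinarith [mul_nonneg hw0 hw0]
      exact h3.trans (h4.trans (by gcongr))
    calc s * t * |w - Real.sin w| ≤ s * t * (w * (2 * v)) := by gcongr
      _ = 2 * (t ^ 2 * v ^ 2) := by linear_combination 2 * v * hstw + 2 * v * e1
      _ ≤ 4 * (t ^ 2 * v ^ e) := by
          have := mul_le_mul_of_nonneg_left h1 (sq_nonneg t)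
          nlinarith [mul_nonneg (sq_nonneg t) hve0]

/-- The spiral of radius `u` and angle `-1 / u`, which starts at the origin. -/
noncomputable def spiral (u : ℝ) : EuclideanSpace ℝ (Fin 2) :=
  !₂[u * Real.cos (1 / u), -(u * Real.sin (1 / u))]

/-- The `i`-th coordinate of a point of `ℝ³`, truncated at the absolute value of the third
coordinate and at `1`. -/
noncomputable def truncatedCoord (i : Fin 3) (b : EuclideanSpace ℝ (Fin 3)) : ℝ :=
  max (-min |b 2| 1) (min (min |b 2| 1) (b i))

/-- The map `ℝ² → ℝ³` that sends the `i`-th basis vector to the `j`-th one and the other basis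
vector to zero. -/
noncomputable def unitMap (i : Fin 2) (j : Fin 3) :
    EuclideanSpace ℝ (Fin 2) →L[ℝ] EuclideanSpace ℝ (Fin 3) :=
  (EuclideanSpace.proj i : StrongDual ℝ (EuclideanSpace ℝ (Fin 2))).smulRight
    (EuclideanSpace.single j 1)

/-- The vector field `dy⁰ = dx⁰, dy¹ = dx¹, dy² = y⁰ dx¹ - y¹ dx⁰`, with the coefficients of the
last equation truncated: the third coordinate measures the area swept by `x`. -/
noncomputable def areaField (b : EuclideanSpace ℝ (Fin 3)) :
    EuclideanSpace ℝ (Fin 2) →L[ℝ] EuclideanSpace ℝ (Fin 3) :=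
  unitMap 0 0 + unitMap 1 1 + truncatedCoord 0 b • unitMap 1 2
    + (-truncatedCoord 1 b) • unitMap 0 2

theorem abs_truncatedCoord_le (i : Fin 3) (b : EuclideanSpace ℝ (Fin 3)) :
    |truncatedCoord i b| ≤ 1 := by
  have h0 : 0 ≤ min |b 2| 1 := le_min (abs_nonneg _) zero_le_one
  have h1 : min |b 2| 1 ≤ 1 := min_le_right _ _
  rw [truncatedCoord, abs_le]
  exact ⟨(neg_le_neg h1).trans (le_max_left _ _),
    max_le (by linarith) ((min_le_left _ _).trans h1)⟩

theorem lipschitzWith_truncatedCoord (i : Fin 3) : LipschitzWith 1 (truncatedCoord i) := by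
  have hc : ∀ j : Fin 3, LipschitzWith 1 fun b : EuclideanSpace ℝ (Fin 3) => b j := fun j =>
    LipschitzWith.of_dist_le_mul fun a b => by
      rw [NNReal.coe_one, one_mul, dist_eq_norm, dist_eq_norm]
      exact PiLp.norm_apply_le (a - b) j
  have habs : LipschitzWith 1 fun b : EuclideanSpace ℝ (Fin 3) => |b 2| := by
    simpa using! lipschitzWith_one_norm.comp (hc 2)
  have hm := habs.min_const 1
  simpa using! hm.neg.max (hm.min (hc i))

theorem isBoundedLipschitz_areaField : IsBoundedLipschitz areaField := by
  refine ⟨⟨‖unitMap 0 0‖ + ‖unitMap 1 1‖ + ‖unitMap 1 2‖ + ‖unitMap 0 2‖, fun b => ?_⟩, ?_⟩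
  · have h : ∀ i, ‖truncatedCoord i b‖ ≤ 1 := fun i => abs_truncatedCoord_le i b
    refine norm_add₄_le.trans ?_
    rw [norm_smul, norm_smul, norm_neg]
    gcongr
    · exact mul_le_of_le_one_left (norm_nonneg _) (h 0)
    · exact mul_le_of_le_one_left (norm_nonneg _) (h 1)
  · have h : ∀ (P : EuclideanSpace ℝ (Fin 2) →L[ℝ] EuclideanSpace ℝ (Fin 3))
        (c : EuclideanSpace ℝ (Fin 3) → ℝ), LipschitzWith 1 c →
        LipschitzWith (‖P‖₊ * 1) fun b => c b • P := fun P c hc =>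
      LipschitzWith.of_dist_le_mul fun a b => by
        have e : c a • P - c b • P = (c a - c b) • P := (sub_smul _ _ _).symm
        rw [dist_eq_norm, e, norm_smul, NNReal.coe_mul, coe_nnnorm, NNReal.coe_one,
          mul_one, mul_comm]
        gcongr
        simpa [dist_eq_norm] using hc.dist_le_mul a b
    exact ⟨_, ((LipschitzWith.const (unitMap 0 0 + unitMap 1 1)).add
      (h _ _ (lipschitzWith_truncatedCoord 0))).add (h _ _ (lipschitzWith_truncatedCoord 1).neg)⟩

theorem areaField_apply (b : EuclideanSpace ℝ (Fin 3)) (v : EuclideanSpace ℝ (Fin 2)) :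
    areaField b v = !₂[v 0, v 1, truncatedCoord 0 b * v 1 - truncatedCoord 1 b * v 0] := by
  ext j
  fin_cases j <;> simp [areaField, unitMap, sub_eq_add_neg]

theorem truncatedCoord_of_abs_le {i : Fin 3} {b : EuclideanSpace ℝ (Fin 3)}
    (h : |b i| ≤ min |b 2| 1) : truncatedCoord i b = b i := by
  rw [truncatedCoord, min_eq_right (abs_le.mp h).2, max_eq_right (abs_le.mp h).1]

theorem truncatedCoord_of_eq_zero {i : Fin 3} {b : EuclideanSpace ℝ (Fin 3)} (h : b 2 = 0) :
    truncatedCoord i b = 0 := by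
  simp [truncatedCoord, h]

theorem norm_two_le (a b : ℝ) : ‖(!₂[a, b] : EuclideanSpace ℝ (Fin 2))‖ ≤ |a| + |b| := by
  rw [EuclideanSpace.norm_eq, Fin.sum_univ_two]
  simp only [Real.norm_eq_abs, Matrix.cons_val_zero, Matrix.cons_val_one, sq_abs]
  rw [Real.sqrt_le_left (by positivity)]
  nlinarith [abs_nonneg a, abs_nonneg b, sq_abs a, sq_abs b]

theorem hasFinitePVariation_spiral {p : ℝ} (hp1 : 1 < p) (hp2 : p < 2) :
    HasFinitePVariation 1 p (fun s t => (t ^ (p - 1) - s ^ (p - 1)) / (p - 1)) spiral := by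
  have hp0 : 0 < p := by linarith
  have hω := isControl_rpow (show 0 < p - 1 by linarith) (by linarith)
  have H : ∀ s t, 0 ≤ s → s ≤ t → t ≤ 1 →
      dist (spiral s) (spiral t) ≤ 4 * ((t ^ (p - 1) - s ^ (p - 1)) / (p - 1)) ^ (1 / p) := by
    intro s t hs hst ht1
    have hn := hω.nonneg s t hs hst ht1
    rcases (hs.trans hst).eq_or_lt with rfl | ht
    · obtain rfl : s = 0 := le_antisymm hst hs
      rw [dist_self]
      positivity
    have hd : 0 ≤ t - s := by linarith
    have he : 1 / p ≤ 1 := by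
      rw [div_le_one hp0]
      exact hp1.le
    have h1 := abs_mul_comp_one_div_sub_le Real.abs_cos_le_one Real.abs_cos_sub_cos_le hs hst ht
      ht1 (by positivity) he
    have h2 := abs_mul_comp_one_div_sub_le Real.abs_sin_le_one Real.abs_sin_sub_sin_le hs hst ht
      ht1 (by positivity) he
    have h3 : t * ((t - s) / t ^ 2) ^ (1 / p) ≤
        ((t ^ (p - 1) - s ^ (p - 1)) / (p - 1)) ^ (1 / p) := by
      have e : t * ((t - s) / t ^ 2) ^ (1 / p) = (t ^ p * ((t - s) / t ^ 2)) ^ (1 / p) := by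
        rw [Real.mul_rpow (by positivity) (by positivity), ← Real.rpow_mul ht.le,
          mul_one_div_cancel hp0.ne', Real.rpow_one]
      rw [e]
      exact Real.rpow_le_rpow (by positivity) (rpow_mul_le_rpow_sub_rpow_div hp1 hp2 hs ht)
        (by positivity)
    have e : spiral t - spiral s = !₂[t * Real.cos (1 / t) - s * Real.cos (1 / s),
        -(t * Real.sin (1 / t) - s * Real.sin (1 / s))] := by
      ext j
      fin_cases j <;> simp [spiral]
      ring
    rw [dist_comm, dist_eq_norm, e]
    refine (norm_two_le _ _).trans ?_
    rw [abs_neg]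
    linarith
  exact ⟨hω.continuousOn_of_dist_le le_rfl (by positivity) H, 4, H⟩

/-- The solution along which the third coordinate takes off from zero together with the spiral, and
remains as large as its radius, so that the truncation in `areaField` is not active. -/
noncomputable def liftedSpiral (u : ℝ) : EuclideanSpace ℝ (Fin 3) :=
  !₂[u * Real.cos (1 / u), -(u * Real.sin (1 / u)), u]

/-- The solution along which the third coordinate stays zero. -/
noncomputable def flatSpiral (u : ℝ) : EuclideanSpace ℝ (Fin 3) :=
  !₂[u * Real.cos (1 / u), -(u * Real.sin (1 / u)), 0]

theorem continuousOn_spiral_third {p : ℝ} (hp1 : 1 < p) (hp2 : p < 2) {h : ℝ → ℝ}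
    (hh : Continuous h) : ContinuousOn (fun u => (!₂[u * Real.cos (1 / u),
      -(u * Real.sin (1 / u)), h u] : EuclideanSpace ℝ (Fin 3))) (Icc 0 1) := by
  have hc := (hasFinitePVariation_spiral hp1 hp2).1
  have h0 : ∀ i : Fin 2, ContinuousOn (fun u => spiral u i) (Icc 0 1) := fun i =>
    (EuclideanSpace.proj i : StrongDual ℝ (EuclideanSpace ℝ (Fin 2))).continuous.comp_continuousOn
      hc
  refine (PiLp.continuous_toLp 2 _).comp_continuousOn (continuousOn_pi.mpr fun j => ?_)
  fin_cases j
  · exact h0 0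
  · exact h0 1
  · exact hh.continuousOn

theorem isDSolution_flatSpiral {p : ℝ} (hp1 : 1 < p) (hp2 : p < 2) :
    IsDSolution 1 (fun s t => (t ^ (p - 1) - s ^ (p - 1)) / (p - 1)) (fun u => u ^ (2 / p))
      (fun b => 1 + ‖areaField b‖) (eulerScheme areaField spiral) 0 0 flatSpiral := by
  refine ⟨continuousOn_spiral_third hp1 hp2 continuous_const, ?_, 0, fun s t _ _ _ => ?_⟩
  · ext j
    fin_cases j <;> simp [flatSpiral]
  · have e : flatSpiral t = eulerScheme areaField spiral t s (flatSpiral s) := by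
      rw [eulerScheme, areaField_apply, truncatedCoord_of_eq_zero (by simp [flatSpiral]),
        truncatedCoord_of_eq_zero (by simp [flatSpiral])]
      ext j
      fin_cases j <;> simp [flatSpiral, spiral]
    rw [← e, dist_self, zero_mul, zero_mul]

theorem isDSolution_liftedSpiral {p : ℝ} (hp1 : 1 < p) (hp2 : p < 2) :
    IsDSolution 1 (fun s t => (t ^ (p - 1) - s ^ (p - 1)) / (p - 1)) (fun u => u ^ (2 / p))
      (fun b => 1 + ‖areaField b‖) (eulerScheme areaField spiral) 0 0 liftedSpiral := by
  have hp0 : 0 < p := by linarith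
  refine ⟨continuousOn_spiral_third hp1 hp2 continuous_id, ?_, 4, fun s t hs hst ht1 => ?_⟩
  · ext j
    fin_cases j <;> simp [liftedSpiral]
  have hω := isControl_rpow (show 0 < p - 1 by linarith) (by linarith)
  have hn := hω.nonneg s t hs hst ht1
  have hN : 1 ≤ 1 + ‖areaField 0‖ := le_add_of_nonneg_right (norm_nonneg _)
  have hmin : min |s| 1 = s := by
    rw [abs_of_nonneg hs, min_eq_left (hst.trans ht1)]
  have t0 : truncatedCoord 0 (liftedSpiral s) = s * Real.cos (1 / s) :=
    truncatedCoord_of_abs_le (by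
      simp only [liftedSpiral, PiLp.toLp_apply, Matrix.cons_val, hmin]
      rw [abs_mul, abs_of_nonneg hs]
      exact mul_le_of_le_one_right hs (Real.abs_cos_le_one _))
  have t1 : truncatedCoord 1 (liftedSpiral s) = -(s * Real.sin (1 / s)) :=
    truncatedCoord_of_abs_le (by
      simp only [liftedSpiral, PiLp.toLp_apply, Matrix.cons_val, hmin]
      rw [abs_neg, abs_mul, abs_of_nonneg hs]
      exact mul_le_of_le_one_right hs (Real.abs_sin_le_one _))
  have e : liftedSpiral t - eulerScheme areaField spiral t s (liftedSpiral s) =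
      EuclideanSpace.single 2 ((t - s) - s * t * Real.sin (1 / s - 1 / t)) := by
    rw [eulerScheme, areaField_apply, t0, t1, Real.sin_sub]
    ext j
    fin_cases j <;> simp [liftedSpiral, spiral]
    ring
  rw [dist_eq_norm, e, PiLp.norm_single, Real.norm_eq_abs]
  rcases (hs.trans hst).eq_or_lt with rfl | ht
  · obtain rfl : s = 0 := le_antisymm hst hs
    simp only [sub_self, zero_mul, abs_zero]
    positivity
  have hd : 0 ≤ t - s := by linarith
  refine (abs_sub_area_le hs hst ht ht1 (e := 2 / p) ?_ ?_).trans ?_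
  · rw [le_div_iff₀ hp0]
    linarith
  · rw [div_le_iff₀ hp0]
    linarith
  have e2 : t ^ 2 * ((t - s) / t ^ 2) ^ (2 / p) = (t ^ p * ((t - s) / t ^ 2)) ^ (2 / p) := by
    rw [Real.mul_rpow (by positivity) (by positivity), ← Real.rpow_mul ht.le,
      mul_div_cancel₀ _ hp0.ne', Real.rpow_two]
  rw [e2, mul_assoc]
  have h3 : (t ^ p * ((t - s) / t ^ 2)) ^ (2 / p) ≤
      ((t ^ (p - 1) - s ^ (p - 1)) / (p - 1)) ^ (2 / p) :=
    Real.rpow_le_rpow (by positivity) (rpow_mul_le_rpow_sub_rpow_div hp1 hp2 hs ht)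
      (by positivity)
  gcongr
  exact h3.trans (le_mul_of_one_le_left (by positivity) hN)

end Spiral

theorem mainTheorem6 (p : ℝ) (hp1 : 1 ≤ p) (hp2 : p < 2) :
    (∀ (U : Type*) (V : Type*) [NormedAddCommGroup U] [NormedSpace ℝ U] [CompleteSpace U]
      [NormedAddCommGroup V] [NormedSpace ℝ V] [FiniteDimensional ℝ V]
      [MeasurableSpace V] [BorelSpace V]
      (T : ℝ) (ω : ℝ → ℝ → ℝ) (x : ℝ → U) (f : V → U →L[ℝ] V),
      0 < T → IsControl T ω → HasFinitePVariation T p ω x → IsBoundedLipschitz f →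
      ∃ (K : ℝ) (δ : ℝ → ℝ), 1 ≤ K ∧
        IsLipschitzAlmostFlow T ω (fun u => u ^ (2 / p)) (fun a => K * (1 + ‖f a‖)) δ
          (eulerScheme f x) ∧
        ∃ ψ : ℝ → ℝ → V → V,
          IsFlow T ψ ∧
          SameGalaxy T ω (fun u => u ^ (2 / p)) (fun a => K * (1 + ‖f a‖)) (eulerScheme f x) ψ ∧
          (∀ s t, 0 ≤ s → s ≤ t → t ≤ T → Measurable (ψ t s)) ∧
          (∀ s a, 0 ≤ s → s ≤ T → ContinuousOn (fun t => ψ t s a) (Icc s T))) ∧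
    (1 < p →
      ∃ (d m : ℕ) (T : ℝ) (ω : ℝ → ℝ → ℝ) (x : ℝ → EuclideanSpace ℝ (Fin d))
        (f : EuclideanSpace ℝ (Fin m) → EuclideanSpace ℝ (Fin d) →L[ℝ] EuclideanSpace ℝ (Fin m))
        (a : EuclideanSpace ℝ (Fin m)) (y z : ℝ → EuclideanSpace ℝ (Fin m)),
        0 < T ∧ IsControl T ω ∧ HasFinitePVariation T p ω x ∧ IsBoundedLipschitz f ∧
        IsDSolution T ω (fun u => u ^ (2 / p)) (fun b => 1 + ‖f b‖) (eulerScheme f x) 0 a y ∧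
        IsDSolution T ω (fun u => u ^ (2 / p)) (fun b => 1 + ‖f b‖) (eulerScheme f x) 0 a z ∧
        ∃ t ∈ Icc 0 T, y t ≠ z t) := by
  refine ⟨fun U V _ _ _ _ _ _ _ _ T ω x f hT hω hx hf =>
    exists_measurable_flow_in_galaxy hp1 hp2 hT hω hx hf, fun hp => ?_⟩
  refine ⟨2, 3, 1, _, spiral, areaField, 0, liftedSpiral, flatSpiral, one_pos,
    isControl_rpow (show 0 < p - 1 by linarith) (by linarith), hasFinitePVariation_spiral hp hp2,
    isBoundedLipschitz_areaField, isDSolution_liftedSpiral hp hp2, isDSolution_flatSpiral hp hp2,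
    1, by simp, fun h => ?_⟩
  have := congrArg (fun v : EuclideanSpace ℝ (Fin 3) => v 2) h
  simp [liftedSpiral, flatSpiral] at this
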